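/- Let $W,V:\mathbb R\to\mathbb R$ be strictly increasing, $W$ right-continuous and $V$ left-continuous, with $W(x+1)-W(x)=W(1)-W(0)$ and $V(x+1)-V(x)=V(1)-V(0)$ for all $x$, and with $W(0)=V(0)=0$, both functions being continuous at $0$ (jumps elsewhere are allowed). Let $dW$, $dV$ be the finite measures on $\mathbb T=\mathbb R/\mathbb Z$ given by $dW((a,b])=W(b)-W(a)$ and $dV([a,b))=V(b)-V(a)$, let $L^2_W(\mathbb T)$, $L^2_V(\mathbb T)$ be the corresponding real $L^2$ spaces, with norms $\|\cdot\|_W,\|\cdot\|_V$, and write $L^2_{V,0}(\mathbb T)=\{u\in L^2_V(\mathbb T):\int_{\mathbb T}u\,dV=0\}$. **Strong derivatives and smooth functions.** For functions $f,g:\mathbb T\to\mathbb R$ put $$D^-_Wf(x)=\lim_{h\to0^-}\frac{f(x+h)-f(x)}{W(x+h)-W(x)},\qquad D^+_Vg(x)=\lim_{h\to0^+}\frac{g(x+h)-g(x)}{V(x+h)-V(x)},$$ where a derivative exists if the limit exists at every $x\in\mathbb T$. Let $C_0(\mathbb T)$ be the set of càdlàg $f$ with $\int f\,dV=0$ and $C_1(\mathbb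 T)$ the set of càglàd $f$ with $\int f\,dW=0$. Let $D^{(n)}_{W,V}=\cdots D^+_VD^-_W$ ($n$ alternating factors, $D^-_W$ applied first) and $D^{(n)}_{V,W}=\cdots D^-_WD^+_V$ ($n$ alternating factors, $D^+_V$ applied first). Then $C^\infty_{W,V}(\mathbb T)$ is the set of functions $c+g$ with $c\in\mathbb R$, $g\in C_0(\mathbb T)$, such that for every $n\ge1$ the derivative $D^{(n)}_{W,V}g$ exists and lies in $C_0(\mathbb T)$ for even $n$ and in $C_1(\mathbb T)$ for odd $n$. Likewise $C^\infty_{V,W}(\mathbb T)$ is the set of $c+g$ with $c\in\mathbb R$, $g\in C_1(\mathbb T)$, such that for every $n\ge1$ the derivative $D^{(n)}_{V,W}g$ exists and lies in $C_1(\mathbb T)$ for even $n$ and in $C_0(\mathbb T)$ for odd $n$. **Sobolev spaces.** $F\in L^2_W(\mathbb T)$ is the weak derivative $D^-_Wf$ of $f\in L^2_V(\mathbb T)$ if $\int fD^+_Vg\,dV=-\int Fg\,dW$ for all $g\in C^\infty_{V,W}(\mathbb T)$, and $G\in L^2_V(\mathbb T)$ is the weak derivative $D^+_VF$ of $F\in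 L^2_W(\mathbb T)$ if $\int FD^-_Wg\,dW=-\int Gg\,dV$ for all $g\in C^\infty_{W,V}(\mathbb T)$. For $f\in L^2_V(\mathbb T)$ the weak derivative $D^{(n)}_{W,V}f$ is obtained by applying alternately $n$ weak derivatives, $D^-_W$ first. Let $\kappa(n)=W$ for odd $n$ and $\kappa(n)=V$ for even $n$. For $k\in\mathbb N=\{0,1,2,\dots\}$, $H^k_{W,V}(\mathbb T)$ is the set of $f\in L^2_V(\mathbb T)$ for which the weak derivative $D^{(n)}_{W,V}f\in L^2_{\kappa(n)}(\mathbb T)$ exists for $n=1,\dots,k$, with the norm $$\|f\|_{k,W,V}^2=\|f\|_V^2+\sum_{n=1}^k\|D^{(n)}_{W,V}f\|^2_{\kappa(n)}.$$ **Laplacian.** $f\in L^2_V(\mathbb T)$ is in the domain of $\Delta_{W,V}$, with $\Delta_{W,V}f=u$, if $u\in L^2_{V,0}(\mathbb T)$ and there are $a,b\in\mathbb R$ with $bW(1)+\int_{(0,1]}\int_{[0,y)}u\,dV\,dW(y)=0$ and $$f(x)=a+bW(x)+\int_{(0,x]}\int_{[0,y)}u(s)\,dV(s)\,dW(y)\quad\text{for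 }V\text{-a.e. }x\in(0,1].$$ An *eigensystem* is a complete orthonormal system $(\nu_i)_{i\ge0}$ of $L^2_V(\mathbb T)$ with reals $0=\lambda_0\le\lambda_1\le\lambda_2\le\cdots$ such that $-\Delta_{W,V}\nu_i=\lambda_i\nu_i$ for all $i\ge 0$. **Theorem.** 1. An eigensystem with $\lambda_i\to\infty$ exists. 2. For every eigensystem $(\nu_i,\lambda_i)_{i\ge0}$ and every $k\in\mathbb N$, $$H^k_{W,V}(\mathbb T)=\Big\{f\in L^2_V(\mathbb T): f=\alpha_0+\sum_{i=1}^\infty\alpha_i\nu_i\ \text{ for some real numbers } \alpha_i \text{ with }\ \sum_{i=1}^\infty\lambda_i^k\alpha_i^2<\infty\Big\},$$ where $\alpha_0$ is a constant function and the series converges in $L^2_V(\mathbb T)$. 3. For every $k\in\mathbb N$, $C^\infty_{W,V}(\mathbb T)\subset H^k_{W,V}(\mathbb T)$, and $C^\infty_{W,V}(\mathbb T)$ is dense in $H^k_{W,V}(\mathbb T)$ with respect to $\|\cdot\|_{k,W,V}$. -/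

import Mathlib

open MeasureTheory Set Filter Topology

/-- A pair of strictly increasing functions `W`, `V` on the line, `W` right-continuous and `V`
left-continuous (the other one-sided limits exist by monotonicity), with periodic increments, both
vanishing and continuous at the origin. Both may have jumps elsewhere. -/
structure WVPair where
  W : ℝ → ℝ
  V : ℝ → ℝ
  W_strictMono : StrictMono W
  V_strictMono : StrictMono V
  W_rightCont : ∀ x, ContinuousWithinAt W (Ici x) x
  V_leftCont : ∀ x, ContinuousWithinAt V (Iic x) x
  W_periodic : ∀ x, W (x + 1) - W x = W 1 - W 0
  V_periodic : ∀ x, V (x + 1) - V x = V 1 - V 0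
  W_zero : W 0 = 0
  V_zero : V 0 = 0
  W_contAt_zero : ContinuousAt W 0
  V_contAt_zero : ContinuousAt V 0

namespace WVPair

noncomputable section

/-! ### Measures and `L²` spaces -/

/-- The measure `dW` on the line; `dW (a, b] = W b - W a`, see `dW_Ioc`. -/
def dW (P : WVPair) : Measure ℝ := P.W_strictMono.monotone.stieltjesFunction.measure

/-- The measure `dV` on the line; `dV [a, b) = V b - V a`, see `dV_Ico`. -/
def dV (P : WVPair) : Measure ℝ := P.V_strictMono.monotone.stieltjesFunction.measure

theorem dW_Ioc (P : WVPair) (a b : ℝ) : P.dW (Ioc a b) = ENNReal.ofReal (P.W b - P.W a) := by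
  have h : ∀ x, P.W_strictMono.monotone.stieltjesFunction x = P.W x := fun x =>
    (P.W_strictMono.monotone.stieltjesFunction_eq x).trans
      (P.W_strictMono.monotone.continuousWithinAt_Ioi_iff_rightLim_eq.1
        ((P.W_rightCont x).mono Ioi_subset_Ici_self))
  have h2 := StieltjesFunction.measure_Ioc P.W_strictMono.monotone.stieltjesFunction a b
  rw [h, h] at h2
  exact h2

theorem dV_Ico (P : WVPair) (a b : ℝ) : P.dV (Ico a b) = ENNReal.ofReal (P.V b - P.V a) := by
  have h : ∀ x, Function.leftLim P.V_strictMono.monotone.stieltjesFunction x = P.V x := by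
    intro x
    have h1 : (P.V_strictMono.monotone.stieltjesFunction : ℝ → ℝ) = Function.rightLim P.V :=
      funext fun y => P.V_strictMono.monotone.stieltjesFunction_eq y
    have h3 : Function.leftLim P.V x = P.V x :=
      P.V_strictMono.monotone.continuousWithinAt_Iio_iff_leftLim_eq.1
        ((P.V_leftCont x).mono Iio_subset_Iic_self)
    rw [h1, leftLim_rightLim (P.V_strictMono.monotone.tendsto_leftLim x), h3]
  have h2 := StieltjesFunction.measure_Ico P.V_strictMono.monotone.stieltjesFunction a b
  rw [h, h] at h2
  exact h2

/-- The measures on the torus `𝕋 = ℝ / ℤ`, indexed by a level `n` considered modulo `2`: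
`dV` at even levels, `dW` at odd levels. The point `0` of the torus carries no mass. -/
def meas (P : WVPair) : ℕ → Measure UnitAddCircle
  | 0 => (P.dV.restrict (Ioc 0 1)).map (fun x : ℝ => (x : UnitAddCircle))
  | 1 => (P.dW.restrict (Ioc 0 1)).map (fun x : ℝ => (x : UnitAddCircle))
  | n + 2 => P.meas n

instance isFiniteMeasure_meas (P : WVPair) : (n : ℕ) → IsFiniteMeasure (P.meas n)
  | 0 => by
      have : IsFiniteMeasure (P.dV.restrict (Ioc 0 1)) := ⟨by
        rw [Measure.restrict_apply_univ, dV, StieltjesFunction.measure_Ioc]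
        exact ENNReal.ofReal_lt_top⟩
      exact Measure.isFiniteMeasure_map _ _
  | 1 => by
      have : IsFiniteMeasure (P.dW.restrict (Ioc 0 1)) := ⟨by
        rw [Measure.restrict_apply_univ, dW, StieltjesFunction.measure_Ioc]
        exact ENNReal.ofReal_lt_top⟩
      exact Measure.isFiniteMeasure_map _ _
  | n + 2 => by
      have := isFiniteMeasure_meas P n
      exact this

/-- `L²_V(𝕋)` at even levels, `L²_W(𝕋)` at odd levels. -/
abbrev L2 (P : WVPair) (n : ℕ) : Type := Lp ℝ 2 (P.meas n)

/-! ### Strong lateral derivatives and smooth functions -/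

/-- Right-continuous with left limits. -/
def IsCadlag (f : UnitAddCircle → ℝ) : Prop :=
  ∀ x : ℝ, ContinuousWithinAt (fun y : ℝ => f y) (Ici x) x ∧
    ∃ l : ℝ, Tendsto (fun y : ℝ => f y) (𝓝[<] x) (𝓝 l)

/-- Left-continuous with right limits. -/
def IsCaglad (f : UnitAddCircle → ℝ) : Prop :=
  ∀ x : ℝ, ContinuousWithinAt (fun y : ℝ => f y) (Iic x) x ∧
    ∃ l : ℝ, Tendsto (fun y : ℝ => f y) (𝓝[>] x) (𝓝 l)

/-- `f` is `W`-left differentiable at every point of the torus, with `D⁻_W f = g`. -/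
def IsLeftDeriv (W : ℝ → ℝ) (f g : UnitAddCircle → ℝ) : Prop :=
  ∀ x : ℝ, Tendsto (fun y : ℝ => (f y - f x) / (W y - W x)) (𝓝[<] x) (𝓝 (g x))

/-- `f` is `V`-right differentiable at every point of the torus, with `D⁺_V f = g`. -/
def IsRightDeriv (V : ℝ → ℝ) (f g : UnitAddCircle → ℝ) : Prop :=
  ∀ x : ℝ, Tendsto (fun y : ℝ => (f y - f x) / (V y - V x)) (𝓝[>] x) (𝓝 (g x))

/-- At even levels the space `C₀(𝕋)` of càdlàg functions with `∫ f dV = 0`; at odd levels the space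
`C₁(𝕋)` of càglàd functions with `∫ f dW = 0`. -/
def MemC (P : WVPair) : ℕ → (UnitAddCircle → ℝ) → Prop
  | 0, f => IsCadlag f ∧ ∫ x, f x ∂(P.meas 0) = 0
  | 1, f => IsCaglad f ∧ ∫ x, f x ∂(P.meas 1) = 0
  | n + 2, f => P.MemC n f

/-- The strong derivative leading from level `n` to level `n + 1`: it is `D⁻_W` at even levels and
`D⁺_V` at odd levels. -/
def IsDeriv (P : WVPair) : ℕ → (UnitAddCircle → ℝ) → (UnitAddCircle → ℝ) → Prop
  | 0, f, g => IsLeftDeriv P.W f g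
  | 1, f, g => IsRightDeriv P.V f g
  | n + 2, f, g => P.IsDeriv n f g

/-- The `n`-fold strong derivative of `f`, starting at level `m`, exists and equals `g`.
For `m = 0` this is `D⁽ⁿ⁾_{W,V} f = g` (so `D⁻_W` is applied first, then `D⁺_V`, and so on);
for `m = 1` it is `D⁽ⁿ⁾_{V,W} f = g` (with `D⁺_V` applied first). -/
def IsIterDeriv (P : WVPair) (m : ℕ) : ℕ → (UnitAddCircle → ℝ) → (UnitAddCircle → ℝ) → Prop
  | 0, f, g => g = f
  | n + 1, f, g => ∃ h, P.IsIterDeriv m n f h ∧ P.IsDeriv (m + n) h g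

/-- The class `Cⁿ_{W,V,0}(𝕋)` for `m = 0`, and `Cⁿ_{V,W,0}(𝕋)` for `m = 1`. -/
def CnZero (P : WVPair) (m n : ℕ) : Set (UnitAddCircle → ℝ) :=
  {f | P.MemC m f ∧ ∃ g, P.IsIterDeriv m n f g ∧ P.MemC (m + n) g}

/-- The smooth functions `⟨1⟩ ⊕ ⋂_{n ≥ 1} Cⁿ_{·,0}`: this is `C^∞_{W,V}(𝕋)` for `m = 0` and
`C^∞_{V,W}(𝕋)` for `m = 1`. -/
def CInf (P : WVPair) (m : ℕ) : Set (UnitAddCircle → ℝ) :=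
  {f | ∃ c : ℝ, ∃ g ∈ ⋂ n ∈ Ici 1, P.CnZero m n, f = fun x => c + g x}

/-! ### Weak derivatives and Sobolev spaces -/

/-- `F` is a weak derivative of `f`, leading from level `n` to level `n + 1`. At even levels this is
the weak `W`-left derivative: `∫ f D⁺_V g dV = - ∫ F g dW` for all `g ∈ C^∞_{V,W}(𝕋)`; at odd levels
the weak `V`-right derivative: `∫ f D⁻_W g dW = - ∫ F g dV` for all `g ∈ C^∞_{W,V}(𝕋)`. -/
def IsWeakDeriv (P : WVPair) (n : ℕ) (f : P.L2 n) (F : P.L2 (n + 1)) : Prop :=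
  ∀ g ∈ P.CInf (n + 1), ∀ g' : UnitAddCircle → ℝ, P.IsDeriv (n + 1) g g' →
    ∫ x, f x * g' x ∂(P.meas n) = -∫ x, F x * g x ∂(P.meas (n + 1))

/-- `F` is the `n`-th weak derivative `D⁽ⁿ⁾_{W,V} f` of `f ∈ L²_V(𝕋)`. -/
def IsIterWeakDeriv (P : WVPair) : (n : ℕ) → P.L2 0 → P.L2 n → Prop
  | 0, f, F => F = f
  | n + 1, f, F => ∃ G : P.L2 n, P.IsIterWeakDeriv n f G ∧ P.IsWeakDeriv n G F

/-- The Sobolev space `H^k_{W,V}(𝕋)`. -/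
def Hk (P : WVPair) (k : ℕ) : Set (P.L2 0) :=
  {f | ∀ n ∈ Finset.Icc 1 k, ∃ F : P.L2 n, P.IsIterWeakDeriv n f F}

open Classical in
/-- The `n`-th weak derivative of `f` (zero by convention where there is none). -/
def weakDeriv (P : WVPair) (n : ℕ) (f : P.L2 0) : P.L2 n :=
  if h : ∃ F : P.L2 n, P.IsIterWeakDeriv n f F then h.choose else 0

/-- The norm of `H^k_{W,V}(𝕋)`. -/
def sobNorm (P : WVPair) (k : ℕ) (f : P.L2 0) : ℝ :=
  Real.sqrt (‖f‖ ^ 2 + ∑ i ∈ Finset.Icc 1 k, ‖P.weakDeriv i f‖ ^ 2)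

/-- The elements of `L²_V(𝕋)` represented by a function in `C^∞_{W,V}(𝕋)`. -/
def smoothClasses (P : WVPair) : Set (P.L2 0) :=
  {h | ∃ g ∈ P.CInf 0, h =ᵐ[P.meas 0] g}

/-! ### The Laplacian and its eigenfunctions -/

/-- `f` lies in the domain `𝓓_{W,V}(𝕋)` and `Δ_{W,V} f = u`. -/
def IsLaplacian (P : WVPair) (f u : P.L2 0) : Prop :=
  ∫ x, u x ∂(P.meas 0) = 0 ∧
  ∃ a b : ℝ,
    b * P.W 1 + ∫ y in Ioc (0 : ℝ) 1, (∫ s in Ico (0 : ℝ) y, u (s : UnitAddCircle) ∂P.dV) ∂P.dW = 0 ∧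
    ∀ᵐ x : ℝ ∂(P.dV.restrict (Ioc 0 1)), f (x : UnitAddCircle) =
      a + P.W x * b + ∫ y in Ioc (0 : ℝ) x, (∫ s in Ico (0 : ℝ) y, u (s : UnitAddCircle) ∂P.dV) ∂P.dW

/-- `(ν i)` is a complete orthonormal system of `L²_V(𝕋)` consisting of eigenfunctions,
`-Δ_{W,V} (ν i) = lam i • ν i`, with `0 = lam 0 ≤ lam 1 ≤ lam 2 ≤ ⋯`. -/
structure IsEigenbasis (P : WVPair) (ν : ℕ → P.L2 0) (lam : ℕ → ℝ) : Prop where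
  orthonormal : Orthonormal ℝ ν
  complete : (Submodule.span ℝ (range ν)).topologicalClosure = ⊤
  eigen : ∀ i, P.IsLaplacian (ν i) (-(lam i • ν i))
  lam_zero : lam 0 = 0
  lam_mono : Monotone lam

end

end WVPair

/-! On one period both lateral derivatives invert primitives. The primitive `primW F x`, the
`dW`-integral of `F` over `t ≤ x`, is right-continuous and has left `W`-derivative `F` wherever `F`
is left-continuous; `primV G x`, the `dV`-integral over `t < x`, is its mirror image. One closed and
one open end point are exactly what Fubini on the triangle `t ≤ x` produces, so integration by parts
holds without correction terms at common atoms (`integral_primW_mul`).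

Existence: let `A = intV₀` send `u` to its `dV`-primitive, with means removed before and after.
Point evaluations of the primitive are uniformly bounded functionals on `L²_V`, so `A` turns weak
into norm convergence and is compact. By parts, the adjoint of `A` is minus the `dW`-primitive up to
constants, so `invLap`, the adjoint of `A` composed with `A`, is a compact positive inverse of `-Δ`
whose kernel is the constants. The spectral theorem and a sorting of the inverted eigenvalues give
the eigensystem.

Spectral description: in any eigensystem each `ν i` has a representative `φ i` solving the
eigenvalue equation at every point. Integration by parts shows that the derivatives `ψ i`, divided
by `√(lam i)` for `i ≥ 1`, form together with a constant a Hilbert basis of `L²_W`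
(`IsEigenbasis.exists_system`). The strong derivatives then act diagonally between the two bases,
with factors `±√(lam i)`. All basis functions are smooth, hence test functions, and Parseval shows
that weak derivatives act by the same factors (`IsSystem.isWeakDeriv_iff`). So the `n`-th weak
derivative of `f` exists exactly when the series of `lam i ^ n` times the squared coefficients
converges, and its squared norm is the sum of that series. This describes `H^k`; density follows
since partial sums are smooth and their errors are tails of convergent series. -/

namespace WVPair

noncomputable section

/-! ### The measures on the unit interval -/

/-- The restriction of `dV` to the unit interval. -/
def mV (P : WVPair) : Measure ℝ := P.dV.restrict (Ioc 0 1)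

/-- The restriction of `dW` to the unit interval. -/
def mW (P : WVPair) : Measure ℝ := P.dW.restrict (Ioc 0 1)

instance (P : WVPair) : IsFiniteMeasure P.mV := ⟨by
  rw [mV, Measure.restrict_apply_univ, dV, StieltjesFunction.measure_Ioc]
  exact ENNReal.ofReal_lt_top⟩

instance (P : WVPair) : IsFiniteMeasure P.mW := ⟨by
  rw [mW, Measure.restrict_apply_univ, dW, StieltjesFunction.measure_Ioc]
  exact ENNReal.ofReal_lt_top⟩

theorem meas_zero (P : WVPair) : P.meas 0 = P.mV.map (fun x : ℝ => (x : UnitAddCircle)) := rfl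

theorem meas_one (P : WVPair) : P.meas 1 = P.mW.map (fun x : ℝ => (x : UnitAddCircle)) := rfl

theorem V_one_pos (P : WVPair) : 0 < P.V 1 := by
  have := P.V_strictMono one_pos
  rwa [P.V_zero] at this

theorem W_one_pos (P : WVPair) : 0 < P.W 1 := by
  have := P.W_strictMono one_pos
  rwa [P.W_zero] at this

/-- The point lies in every `[0, y)`, whose mass `V y` tends to 0 by continuity of `V` at the
origin. This allows `[0, 1)` and `(0, 1]` to be exchanged for `dV`. -/
theorem dV_singleton_zero (P : WVPair) : P.dV {0} = 0 := by
  have h : Tendsto (fun y : ℝ => ENNReal.ofReal (P.V y)) (𝓝[>] 0) (𝓝 0) := by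
    have h1 := P.V_contAt_zero.tendsto.mono_left (nhdsWithin_le_nhds (s := Ioi 0))
    rw [P.V_zero] at h1
    simpa using ENNReal.tendsto_ofReal h1
  refine le_antisymm (ge_of_tendsto h ?_) bot_le
  filter_upwards [self_mem_nhdsWithin] with y hy
  have := P.dV_Ico 0 y
  rw [P.V_zero, sub_zero] at this
  rw [← this]
  exact measure_mono (by simpa using hy)

/-- Periodicity of the increments transports the continuity at 0 to the point 1. -/
theorem dV_singleton_one (P : WVPair) : P.dV {1} = 0 := by
  have h : Tendsto (fun y : ℝ => ENNReal.ofReal (P.V y)) (𝓝[>] 0) (𝓝 0) := by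
    have h1 := P.V_contAt_zero.tendsto.mono_left (nhdsWithin_le_nhds (s := Ioi 0))
    rw [P.V_zero] at h1
    simpa using ENNReal.tendsto_ofReal h1
  refine le_antisymm (ge_of_tendsto h ?_) bot_le
  filter_upwards [self_mem_nhdsWithin] with y hy
  have := P.dV_Ico 1 (y + 1)
  have h2 := P.V_periodic y
  rw [P.V_zero] at h2
  rw [show P.V (y + 1) - P.V 1 = P.V y by linarith] at this
  rw [← this]
  refine measure_mono ?_
  rintro _ rfl
  exact ⟨le_rfl, by linarith [mem_Ioi.1 hy]⟩

theorem mW_Ioc (P : WVPair) {a b : ℝ} (ha : 0 ≤ a) (hab : a ≤ b) (hb : b ≤ 1) :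
    P.mW.real (Ioc a b) = P.W b - P.W a := by
  rw [mW, Measure.real, Measure.restrict_apply measurableSet_Ioc,
    inter_eq_left.2 (Ioc_subset_Ioc ha hb), dW_Ioc,
    ENNReal.toReal_ofReal (sub_nonneg.2 (P.W_strictMono.monotone hab))]

theorem mV_singleton_one (P : WVPair) : P.mV {1} = 0 :=
  le_antisymm ((Measure.restrict_apply_le _ _).trans P.dV_singleton_one.le) bot_le

theorem mV_Iic_zero (P : WVPair) : P.mV (Iic 0) = 0 := by
  rw [mV, Measure.restrict_apply measurableSet_Iic,
    show Iic (0 : ℝ) ∩ Ioc 0 1 = ∅ by ext; simp; intros; linarith, measure_empty]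

theorem mW_Iic_zero (P : WVPair) : P.mW (Iic 0) = 0 := by
  rw [mW, Measure.restrict_apply measurableSet_Iic,
    show Iic (0 : ℝ) ∩ Ioc 0 1 = ∅ by ext; simp; intros; linarith, measure_empty]

theorem mV_Ioi_one (P : WVPair) : P.mV (Ioi 1) = 0 := by
  rw [mV, Measure.restrict_apply measurableSet_Ioi,
    show Ioi (1 : ℝ) ∩ Ioc 0 1 = ∅ by ext; simp; intros; linarith, measure_empty]

theorem mV_Ici_one (P : WVPair) : P.mV (Ici 1) = 0 := by
  rw [← Ioi_union_left]
  exact measure_union_null P.mV_Ioi_one P.mV_singleton_one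

theorem mV_Ico (P : WVPair) {a b : ℝ} (ha : 0 ≤ a) (hab : a ≤ b) (hb : b ≤ 1) :
    P.mV.real (Ico a b) = P.V b - P.V a := by
  have h : (Ico a b ∩ Ioc 0 1 : Set ℝ) =ᵐ[P.dV] Ico a b := by
    filter_upwards [compl_mem_ae_iff.2 P.dV_singleton_zero] with x hx
    refine propext ⟨fun h => h.1, fun h => ⟨h, ?_, h.2.le.trans hb⟩⟩
    exact lt_of_le_of_ne (ha.trans h.1) (Ne.symm hx)
  rw [mV, Measure.real, Measure.restrict_apply measurableSet_Ico, measure_congr h, dV_Ico,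
    ENNReal.toReal_ofReal (sub_nonneg.2 (P.V_strictMono.monotone hab))]

theorem ae_mV_mem (P : WVPair) : ∀ᵐ x ∂P.mV, x ∈ Ioc (0 : ℝ) 1 :=
  ae_restrict_mem measurableSet_Ioc

theorem ae_mW_mem (P : WVPair) : ∀ᵐ x ∂P.mW, x ∈ Ioc (0 : ℝ) 1 :=
  ae_restrict_mem measurableSet_Ioc

theorem mV_univ (P : WVPair) : P.mV.real univ = P.V 1 := by
  have h : (univ : Set ℝ) =ᵐ[P.mV] Ico 0 1 := by
    filter_upwards [P.ae_mV_mem, compl_mem_ae_iff.2 P.mV_singleton_one] with x hx hx1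
    exact propext ⟨fun _ => ⟨hx.1.le, lt_of_le_of_ne hx.2 hx1⟩, fun _ => trivial⟩
  rw [measureReal_congr h, P.mV_Ico le_rfl zero_le_one le_rfl, P.V_zero, sub_zero]

theorem mW_univ (P : WVPair) : P.mW.real univ = P.W 1 := by
  have h : (univ : Set ℝ) =ᵐ[P.mW] Ioc 0 1 := by
    filter_upwards [P.ae_mW_mem] with x hx
    exact propext ⟨fun _ => hx, fun _ => trivial⟩
  rw [measureReal_congr h, P.mW_Ioc le_rfl zero_le_one le_rfl, P.W_zero, sub_zero]

/-! ### Transfer between the torus and the unit interval -/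

theorem measurable_coe_circle : Measurable (fun x : ℝ => (x : UnitAddCircle)) :=
  AddCircle.measurable_mk'

theorem measurable_of_comp_coe {f : UnitAddCircle → ℝ} (hf : Measurable fun x : ℝ => f x) :
    Measurable f := by
  have h : f = (fun x : Ioc (0 : ℝ) (0 + 1) => f (x : ℝ)) ∘
      AddCircle.measurableEquivIoc 1 0 := by
    funext x
    exact congrArg f ((AddCircle.measurableEquivIoc 1 0).symm_apply_apply x).symm
  rw [h]
  exact (hf.comp measurable_subtype_coe).comp (AddCircle.measurableEquivIoc 1 0).measurable

/-- The measure on the unit interval whose image is `meas n`. -/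
def mI (P : WVPair) : ℕ → Measure ℝ
  | 0 => P.mV
  | 1 => P.mW
  | n + 2 => P.mI n

theorem meas_eq (P : WVPair) : ∀ n, P.meas n = (P.mI n).map (fun x : ℝ => (x : UnitAddCircle))
  | 0 => rfl
  | 1 => rfl
  | n + 2 => P.meas_eq n

theorem measurableEmbedding_circle : MeasurableEmbedding
    (fun x : Ioc (0 : ℝ) (0 + 1) => ((x : ℝ) : UnitAddCircle)) :=
  (AddCircle.measurableEquivIoc 1 0).symm.measurableEmbedding

theorem integral_meas (P : WVPair) {n : ℕ} {f : UnitAddCircle → ℝ}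
    (hf : AEStronglyMeasurable f (P.meas n)) :
    ∫ x, f x ∂(P.meas n) = ∫ x, f (x : ℝ) ∂(P.mI n) := by
  rw [meas_eq] at hf ⊢
  exact integral_map measurable_coe_circle.aemeasurable hf

theorem mI_restrict (P : WVPair) : ∀ n, (P.mI n).restrict (Ioc 0 1) = P.mI n
  | 0 => by rw [mI, mV, Measure.restrict_restrict measurableSet_Ioc, inter_self]
  | 1 => by rw [mI, mW, Measure.restrict_restrict measurableSet_Ioc, inter_self]
  | n + 2 => P.mI_restrict n

/-- The quotient map restricted to `(0, 1]` is a measurable embedding, so null sets correspond in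
both directions, with no measurability of `p`. -/
theorem ae_meas_iff (P : WVPair) {n : ℕ} {p : UnitAddCircle → Prop} :
    (∀ᵐ x ∂(P.meas n), p x) ↔ ∀ᵐ x ∂(P.mI n), p (x : ℝ) := by
  have h : P.mI n = ((P.mI n).comap ((↑) : Ioc (0 : ℝ) (0 + 1) → ℝ)).map (↑) := by
    rw [map_comap_subtype_coe measurableSet_Ioc, zero_add, mI_restrict]
  rw [meas_eq, h, Measure.map_map measurable_coe_circle measurable_subtype_coe,
    (MeasurableEmbedding.subtype_coe measurableSet_Ioc).ae_map_iff]
  exact measurableEmbedding_circle.ae_map_iff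

theorem integrable_meas (P : WVPair) {n : ℕ} {f : UnitAddCircle → ℝ}
    (hf : Integrable f (P.meas n)) : Integrable (fun x : ℝ => f x) (P.mI n) := by
  rw [meas_eq] at hf
  exact hf.comp_measurable measurable_coe_circle

/-! ### Lateral limits and continuity on the torus -/

theorem map_add_nhdsWithin_Iio (x t : ℝ) : map (· + t) (𝓝[<] x) = 𝓝[<] (x + t) := by
  simp

theorem map_add_nhdsWithin_Ioi (x t : ℝ) : map (· + t) (𝓝[>] x) = 𝓝[>] (x + t) := by
  simp

theorem tendsto_nhdsLT_add {f : ℝ → ℝ} {x t : ℝ} {l : Filter ℝ} :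
    Tendsto f (𝓝[<] (x + t)) l ↔ Tendsto (fun y => f (y + t)) (𝓝[<] x) l := by
  rw [← map_add_nhdsWithin_Iio, tendsto_map'_iff]; rfl

theorem tendsto_nhdsGT_add {f : ℝ → ℝ} {x t : ℝ} {l : Filter ℝ} :
    Tendsto f (𝓝[>] (x + t)) l ↔ Tendsto (fun y => f (y + t)) (𝓝[>] x) l := by
  rw [← map_add_nhdsWithin_Ioi, tendsto_map'_iff]; rfl

theorem coe_add_int (x : ℝ) (n : ℤ) : ((x + n : ℝ) : UnitAddCircle) = (x : UnitAddCircle) := by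
  simp

/-- Right-sided conditions are checked on `[0, 1)` and left-sided ones on `(0, 1]`, so that small
one-sided neighbourhoods stay inside the period. -/
theorem forall_of_forall_Ico {p : ℝ → Prop} (hp : ∀ x (n : ℤ), p x → p (x + n))
    (h : ∀ x ∈ Ico (0 : ℝ) 1, p x) (x : ℝ) : p x := by
  have := hp _ ⌊x⌋ (h _ ⟨Int.fract_nonneg x, Int.fract_lt_one x⟩)
  rwa [Int.fract_add_floor] at this

theorem forall_of_forall_Ioc {p : ℝ → Prop} (hp : ∀ x (n : ℤ), p x → p (x + n))
    (h : ∀ x ∈ Ioc (0 : ℝ) 1, p x) (x : ℝ) : p x := by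
  have := hp (x - (⌈x⌉ - 1 : ℤ)) (⌈x⌉ - 1) (h _ ⟨?_, ?_⟩)
  · simpa using this
  · push_cast; linarith [Int.ceil_lt_add_one x]
  · push_cast; linarith [Int.le_ceil x]

theorem W_add_int_sub (P : WVPair) (y x : ℝ) (n : ℤ) :
    P.W (y + n) - P.W (x + n) = P.W y - P.W x := by
  -- Subtracting the linear function with the same increment over a period leaves a periodic
  -- function.
  have h : Function.Periodic (fun y => P.W y - P.W 1 * y) 1 := fun z => by
    have := P.W_periodic z
    rw [P.W_zero] at this
    simp only; linarith
  have h1 := h.int_mul n y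
  have h2 := h.int_mul n x
  simp only [mul_one] at h1 h2
  linarith

theorem V_add_int_sub (P : WVPair) (y x : ℝ) (n : ℤ) :
    P.V (y + n) - P.V (x + n) = P.V y - P.V x := by
  have h : Function.Periodic (fun y => P.V y - P.V 1 * y) 1 := fun z => by
    have := P.V_periodic z
    rw [P.V_zero] at this
    simp only; linarith
  have h1 := h.int_mul n y
  have h2 := h.int_mul n x
  simp only [mul_one] at h1 h2
  linarith

theorem isCadlag_iff {f : UnitAddCircle → ℝ} : IsCadlag f ↔ ∀ x : ℝ,
    Tendsto (fun y : ℝ => f y) (𝓝[>] x) (𝓝 (f x)) ∧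
      ∃ l : ℝ, Tendsto (fun y : ℝ => f y) (𝓝[<] x) (𝓝 l) := by
  simp_rw [IsCadlag, ← continuousWithinAt_Ioi_iff_Ici]
  rfl

theorem isCaglad_iff {f : UnitAddCircle → ℝ} : IsCaglad f ↔ ∀ x : ℝ,
    Tendsto (fun y : ℝ => f y) (𝓝[<] x) (𝓝 (f x)) ∧
      ∃ l : ℝ, Tendsto (fun y : ℝ => f y) (𝓝[>] x) (𝓝 l) := by
  simp_rw [IsCaglad, ← continuousWithinAt_Iio_iff_Iic]
  rfl

theorem isCadlag_of {f : UnitAddCircle → ℝ}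
    (h1 : ∀ x ∈ Ico (0 : ℝ) 1, Tendsto (fun y : ℝ => f y) (𝓝[>] x) (𝓝 (f x)))
    (h2 : ∀ x ∈ Ioc (0 : ℝ) 1, ∃ l : ℝ, Tendsto (fun y : ℝ => f y) (𝓝[<] x) (𝓝 l)) :
    IsCadlag f := by
  refine isCadlag_iff.2 fun x => ⟨forall_of_forall_Ico ?_ h1 x, forall_of_forall_Ioc ?_ h2 x⟩
  · intro x n h
    simpa only [tendsto_nhdsGT_add, coe_add_int] using h
  · intro x n h
    simpa only [tendsto_nhdsLT_add, coe_add_int] using h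

theorem isCaglad_of {f : UnitAddCircle → ℝ}
    (h1 : ∀ x ∈ Ioc (0 : ℝ) 1, Tendsto (fun y : ℝ => f y) (𝓝[<] x) (𝓝 (f x)))
    (h2 : ∀ x ∈ Ico (0 : ℝ) 1, ∃ l : ℝ, Tendsto (fun y : ℝ => f y) (𝓝[>] x) (𝓝 l)) :
    IsCaglad f := by
  refine isCaglad_iff.2 fun x => ⟨forall_of_forall_Ioc ?_ h1 x, forall_of_forall_Ico ?_ h2 x⟩
  · intro x n h
    simpa only [tendsto_nhdsLT_add, coe_add_int] using h
  · intro x n h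
    simpa only [tendsto_nhdsGT_add, coe_add_int] using h

theorem isLeftDeriv_of (P : WVPair) {f g : UnitAddCircle → ℝ}
    (h : ∀ x ∈ Ioc (0 : ℝ) 1,
      Tendsto (fun y : ℝ => (f y - f x) / (P.W y - P.W x)) (𝓝[<] x) (𝓝 (g x))) :
    IsLeftDeriv P.W f g := by
  refine fun x => forall_of_forall_Ioc ?_ h x
  intro x n h
  simpa only [tendsto_nhdsLT_add, coe_add_int, W_add_int_sub] using h

theorem isRightDeriv_of (P : WVPair) {f g : UnitAddCircle → ℝ}
    (h : ∀ x ∈ Ico (0 : ℝ) 1,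
      Tendsto (fun y : ℝ => (f y - f x) / (P.V y - P.V x)) (𝓝[>] x) (𝓝 (g x))) :
    IsRightDeriv P.V f g := by
  refine fun x => forall_of_forall_Ico ?_ h x
  intro x n h
  simpa only [tendsto_nhdsGT_add, coe_add_int, V_add_int_sub] using h

theorem coe_one_eq : ((1 : ℝ) : UnitAddCircle) = ((0 : ℝ) : UnitAddCircle) := by
  simp

/-- A function on the unit interval as a function on the torus. -/
def lift (f : ℝ → ℝ) : UnitAddCircle → ℝ := AddCircle.liftIoc 1 0 f

/-- `AddCircle.liftIoc` reads `f` on `(0, 1]` only; equality of the end values brings in the point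
0. -/
theorem lift_coe {f : ℝ → ℝ} (h : f 0 = f 1) {x : ℝ} (hx : x ∈ Icc (0 : ℝ) 1) :
    lift f (x : UnitAddCircle) = f x := by
  rcases eq_or_lt_of_le hx.1 with rfl | h0
  · have : ((0 : ℝ) : UnitAddCircle) = ((1 : ℝ) : UnitAddCircle) := by
      simpa using (coe_add_int 0 1).symm
    rw [this, h]
    exact AddCircle.liftIoc_zero_coe_apply (by simp)
  · exact AddCircle.liftIoc_zero_coe_apply ⟨h0, hx.2⟩

/-! ### Measurability and boundedness -/

/-- Evaluating `f` at the first point of the grid `ℤ / (n + 1)` strictly to the right of `x`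
approximates `f x`. Each approximant factors through an integer-valued floor, hence is measurable.
-/
theorem measurable_of_tendsto_nhdsGT {f : ℝ → ℝ}
    (h : ∀ x, Tendsto f (𝓝[>] x) (𝓝 (f x))) : Measurable f := by
  have hlim : ∀ x : ℝ, Tendsto (fun n : ℕ => ((⌊(n + 1 : ℝ) * x⌋ + 1 : ℤ) : ℝ) / (n + 1))
      atTop (𝓝[>] x) := by
    intro x
    refine tendsto_nhdsWithin_iff.2 ⟨?_, Eventually.of_forall fun n => ?_⟩
    · have h1 : Tendsto (fun n : ℕ => x + 1 / ((n : ℝ) + 1)) atTop (𝓝 (x + 0)) :=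
        tendsto_const_nhds.add tendsto_one_div_add_atTop_nhds_zero_nat
      rw [add_zero] at h1
      refine tendsto_of_tendsto_of_tendsto_of_le_of_le tendsto_const_nhds h1 ?_ ?_
      · intro n
        have hn : (0 : ℝ) < n + 1 := by positivity
        simp only
        rw [le_div_iff₀ hn]
        push_cast
        linarith [Int.lt_floor_add_one ((n + 1 : ℝ) * x)]
      · intro n
        have hn : (0 : ℝ) < n + 1 := by positivity
        simp only
        have h2 : 1 / ((n : ℝ) + 1) * (n + 1) = 1 := one_div_mul_cancel hn.ne'
        rw [div_le_iff₀ hn, add_mul x, h2]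
        push_cast
        linarith [Int.floor_le ((n + 1 : ℝ) * x)]
    · have hn : (0 : ℝ) < n + 1 := by positivity
      rw [mem_Ioi, lt_div_iff₀ hn]
      push_cast
      linarith [Int.lt_floor_add_one ((n + 1 : ℝ) * x)]
  refine measurable_of_tendsto_metrizable
    (f := fun (n : ℕ) x => f (((⌊(n + 1 : ℝ) * x⌋ + 1 : ℤ) : ℝ) / (n + 1))) (fun n => ?_)
    (tendsto_pi_nhds.2 fun x => (h x).comp (hlim x))
  exact (measurable_from_top (f := fun k : ℤ => f (((k + 1 : ℤ) : ℝ) / (n + 1)))).comp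
    (Int.measurable_floor.comp (measurable_const.mul measurable_id))

theorem measurable_of_tendsto_nhdsLT {f : ℝ → ℝ}
    (h : ∀ x, Tendsto f (𝓝[<] x) (𝓝 (f x))) : Measurable f := by
  have h1 : Measurable fun x => f (-x) := by
    refine measurable_of_tendsto_nhdsGT fun x => (h (-x)).comp ?_
    exact tendsto_neg_nhdsGT
  simpa [Function.comp_def] using h1.comp measurable_neg

/-- The two lateral limits and the value bound `f` near each point; compactness of `[0, 1]` leaves
finitely many bounds. -/
theorem exists_bound_of_lateral_limits {f : UnitAddCircle → ℝ}
    (h1 : ∀ x : ℝ, ∃ l : ℝ, Tendsto (fun y : ℝ => f y) (𝓝[<] x) (𝓝 l))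
    (h2 : ∀ x : ℝ, ∃ l : ℝ, Tendsto (fun y : ℝ => f y) (𝓝[>] x) (𝓝 l)) :
    ∃ C, ∀ x, |f x| ≤ C := by
  have key : ∃ C, ∀ x ∈ Icc (0 : ℝ) 1, |f (x : UnitAddCircle)| ≤ C := by
    refine isCompact_Icc.induction_on (p := fun s => ∃ C, ∀ x ∈ s, |f ((x : ℝ) : UnitAddCircle)| ≤ C)
      ⟨0, by simp⟩ (fun s t hst ⟨C, hC⟩ => ⟨C, fun x hx => hC x (hst hx)⟩)
      (fun s t ⟨C, hC⟩ ⟨D, hD⟩ => ⟨max C D, fun x hx => ?_⟩) ?_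
    · rcases hx with hx | hx
      · exact (hC x hx).trans (le_max_left _ _)
      · exact (hD x hx).trans (le_max_right _ _)
    · intro x _
      obtain ⟨l, hl⟩ := h1 x
      obtain ⟨r, hr⟩ := h2 x
      have e1 := hl.abs.eventually_le_const (lt_add_one _)
      have e2 := hr.abs.eventually_le_const (lt_add_one _)
      have e : ∀ᶠ y in 𝓝 x, |f ((y : ℝ) : UnitAddCircle)| ≤
          max |f (x : UnitAddCircle)| (max (|l| + 1) (|r| + 1)) := by
        rw [← nhdsLT_sup_nhdsGE, ← Ioi_union_left, nhdsWithin_union, nhdsWithin_singleton]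
        exact eventually_sup.2 ⟨e1.mono fun y hy => hy.trans (by simp),
          eventually_sup.2 ⟨e2.mono fun y hy => hy.trans (by simp), by simp⟩⟩
      exact ⟨_, mem_nhdsWithin_of_mem_nhds e, _, fun y hy => hy⟩
  obtain ⟨C, hC⟩ := key
  refine ⟨C, fun x => ?_⟩
  obtain ⟨x, rfl⟩ := QuotientAddGroup.mk_surjective x
  exact forall_of_forall_Ico (p := fun x : ℝ => |f (x : UnitAddCircle)| ≤ C)
    (fun x n h => by rwa [coe_add_int]) (fun x hx => hC x ⟨hx.1, hx.2.le⟩) x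

theorem IsCadlag.measurable {f : UnitAddCircle → ℝ} (hf : IsCadlag f) : Measurable f :=
  measurable_of_comp_coe (measurable_of_tendsto_nhdsGT fun x => (isCadlag_iff.1 hf x).1)

theorem IsCaglad.measurable {f : UnitAddCircle → ℝ} (hf : IsCaglad f) : Measurable f :=
  measurable_of_comp_coe (measurable_of_tendsto_nhdsLT fun x => (isCaglad_iff.1 hf x).1)

theorem IsCadlag.bounded {f : UnitAddCircle → ℝ} (hf : IsCadlag f) : ∃ C, ∀ x, |f x| ≤ C :=
  exists_bound_of_lateral_limits (fun x => (hf x).2) fun x => ⟨_, (isCadlag_iff.1 hf x).1⟩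

theorem IsCaglad.bounded {f : UnitAddCircle → ℝ} (hf : IsCaglad f) : ∃ C, ∀ x, |f x| ≤ C :=
  exists_bound_of_lateral_limits (fun x => ⟨_, (isCaglad_iff.1 hf x).1⟩) fun x => (hf x).2

/-! ### Primitives -/

/-- Dominated convergence for indicators. The eventual membership of each point decides whether the
limit set contains its end point, which matters when that point is an atom. -/
theorem tendsto_setIntegral_of_eventually {μ : Measure ℝ} {F : ℝ → ℝ} (hF : Integrable F μ)
    {s : ℝ → Set ℝ} {t : Set ℝ} (hs : ∀ y, MeasurableSet (s y)) (ht : MeasurableSet t)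
    {l : Filter ℝ} [l.IsCountablyGenerated] (h : ∀ a, ∀ᶠ y in l, (a ∈ s y ↔ a ∈ t)) :
    Tendsto (fun y => ∫ x in s y, F x ∂μ) l (𝓝 (∫ x in t, F x ∂μ)) := by
  simp_rw [← integral_indicator (hs _), ← integral_indicator ht]
  refine tendsto_integral_filter_of_dominated_convergence (fun x => ‖F x‖)
    (Eventually.of_forall fun y => hF.aestronglyMeasurable.indicator (hs y))
    (Eventually.of_forall fun y => Eventually.of_forall fun x => norm_indicator_le_norm_self _ _)
    hF.norm (Eventually.of_forall fun x => ?_)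
  refine tendsto_const_nhds.congr' ?_
  filter_upwards [h x] with y hy
  by_cases hx : x ∈ t <;> simp [indicator, hy, hx]

/-- The right-continuous primitive with respect to `dW`. -/
def primW (P : WVPair) (F : ℝ → ℝ) (x : ℝ) : ℝ := ∫ t in Iic x, F t ∂P.mW

/-- The left-continuous primitive with respect to `dV`. -/
def primV (P : WVPair) (G : ℝ → ℝ) (x : ℝ) : ℝ := ∫ t in Iio x, G t ∂P.mV

section

variable {P : WVPair} {F G : ℝ → ℝ}

theorem primW_tendsto_right (hF : Integrable F P.mW) (x : ℝ) :
    Tendsto (P.primW F) (𝓝[>] x) (𝓝 (P.primW F x)) := by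
  refine tendsto_setIntegral_of_eventually hF (fun _ => measurableSet_Iic) measurableSet_Iic
    fun a => ?_
  rcases le_or_gt a x with h | h
  · filter_upwards [self_mem_nhdsWithin] with y hy
    simp only [mem_Iic, mem_Ioi] at hy ⊢
    constructor <;> intro h2 <;> linarith
  · filter_upwards [nhdsWithin_le_nhds (Iio_mem_nhds h)] with y hy
    simp only [mem_Iic, mem_Iio] at hy ⊢
    constructor <;> intro h2 <;> linarith

theorem primW_tendsto_left (hF : Integrable F P.mW) (x : ℝ) :
    Tendsto (P.primW F) (𝓝[<] x) (𝓝 (∫ t in Iio x, F t ∂P.mW)) := by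
  refine tendsto_setIntegral_of_eventually hF (fun _ => measurableSet_Iic) measurableSet_Iio
    fun a => ?_
  rcases lt_or_ge a x with h | h
  · filter_upwards [nhdsWithin_le_nhds (Ioi_mem_nhds h)] with y hy
    simp only [mem_Iic, mem_Iio, mem_Ioi] at hy ⊢
    constructor <;> intro h2 <;> linarith
  · filter_upwards [self_mem_nhdsWithin] with y hy
    simp only [mem_Iic, mem_Iio] at hy ⊢
    constructor <;> intro h2 <;> linarith

theorem primV_tendsto_left (hG : Integrable G P.mV) (x : ℝ) :
    Tendsto (P.primV G) (𝓝[<] x) (𝓝 (P.primV G x)) := by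
  refine tendsto_setIntegral_of_eventually hG (fun _ => measurableSet_Iio) measurableSet_Iio
    fun a => ?_
  rcases lt_or_ge a x with h | h
  · filter_upwards [nhdsWithin_le_nhds (Ioi_mem_nhds h)] with y hy
    simp only [mem_Iio, mem_Ioi] at hy ⊢
    constructor <;> intro h2 <;> linarith
  · filter_upwards [self_mem_nhdsWithin] with y hy
    simp only [mem_Iio] at hy ⊢
    constructor <;> intro h2 <;> linarith

theorem primV_tendsto_right (hG : Integrable G P.mV) (x : ℝ) :
    Tendsto (P.primV G) (𝓝[>] x) (𝓝 (∫ t in Iic x, G t ∂P.mV)) := by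
  refine tendsto_setIntegral_of_eventually hG (fun _ => measurableSet_Iio) measurableSet_Iic
    fun a => ?_
  rcases le_or_gt a x with h | h
  · filter_upwards [self_mem_nhdsWithin] with y hy
    simp only [mem_Iic, mem_Iio, mem_Ioi] at hy ⊢
    constructor <;> intro h2 <;> linarith
  · filter_upwards [nhdsWithin_le_nhds (Iio_mem_nhds h)] with y hy
    simp only [mem_Iic, mem_Iio] at hy ⊢
    constructor <;> intro h2 <;> linarith

theorem primW_zero (P : WVPair) (F : ℝ → ℝ) : P.primW F 0 = 0 :=
  setIntegral_measure_zero _ P.mW_Iic_zero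

theorem primV_zero (P : WVPair) (G : ℝ → ℝ) : P.primV G 0 = 0 :=
  setIntegral_measure_zero _ (measure_mono_null Iio_subset_Iic_self P.mV_Iic_zero)

theorem primW_one (P : WVPair) (F : ℝ → ℝ) : P.primW F 1 = ∫ t, F t ∂P.mW := by
  rw [primW, ← setIntegral_univ (f := F) (μ := P.mW)]
  refine setIntegral_congr_set (μ := P.mW) ?_
  filter_upwards [P.ae_mW_mem] with x hx
  exact propext ⟨fun _ => trivial, fun _ => hx.2⟩

theorem primV_one (P : WVPair) (G : ℝ → ℝ) : P.primV G 1 = ∫ t, G t ∂P.mV := by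
  rw [primV, ← setIntegral_univ (f := G) (μ := P.mV)]
  refine setIntegral_congr_set (μ := P.mV) ?_
  filter_upwards [compl_mem_ae_iff.2 P.mV_Ici_one] with x hx
  exact propext ⟨fun _ => trivial, fun _ => not_le.1 hx⟩

theorem primW_sub (hF : Integrable F P.mW) {y x : ℝ} (h : y ≤ x) :
    P.primW F x - P.primW F y = ∫ t in Ioc y x, F t ∂P.mW := by
  rw [primW, primW, ← Iic_union_Ioc_eq_Iic h, setIntegral_union (by
    rw [disjoint_left]; intro a h1 h2; exact h2.1.not_ge h1) measurableSet_Ioc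
    hF.integrableOn hF.integrableOn, add_sub_cancel_left]

theorem primV_sub (hG : Integrable G P.mV) {y x : ℝ} (h : y ≤ x) :
    P.primV G x - P.primV G y = ∫ t in Ico y x, G t ∂P.mV := by
  rw [primV, primV, ← Iio_union_Ico_eq_Iio h, setIntegral_union (by
    rw [disjoint_left]; intro a h1 h2; exact h2.1.not_gt h1) measurableSet_Ico
    hG.integrableOn hG.integrableOn, add_sub_cancel_left]

theorem abs_setIntegral_sub_le {μ : Measure ℝ} [IsFiniteMeasure μ] {s : Set ℝ}
    (hF : Integrable F μ) {c ε : ℝ} (h : ∀ t ∈ s, |F t - c| ≤ ε) :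
    |∫ t in s, F t ∂μ - c * μ.real s| ≤ ε * μ.real s := by
  have h1 : ∫ t in s, (F t - c) ∂μ = ∫ t in s, F t ∂μ - c * μ.real s := by
    rw [integral_sub hF.integrableOn (integrable_const c)]
    simp [mul_comm]
  rw [← h1]
  exact norm_setIntegral_le_of_norm_le_const (f := fun t => F t - c) (measure_lt_top _ _) h

/-- `W x - W y` is the mass of `(y, x]`, so the quotient is an average of `F` over `(y, x]`. The end
point `x` may carry an atom, but there `F` has exactly the limiting value. -/
theorem primW_leftDeriv (hF : Integrable F P.mW) {x : ℝ} (hx : x ∈ Ioc (0 : ℝ) 1)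
    (h : Tendsto F (𝓝[<] x) (𝓝 (F x))) :
    Tendsto (fun y => (P.primW F y - P.primW F x) / (P.W y - P.W x)) (𝓝[<] x) (𝓝 (F x)) := by
  rw [Metric.tendsto_nhds]
  intro ε hε
  have h1 := (Metric.tendsto_nhds.1 h) (ε / 2) (half_pos hε)
  obtain ⟨a, ha, hsub⟩ := (mem_nhdsLT_iff_exists_Ioo_subset).1 h1
  filter_upwards [Ioo_mem_nhdsLT (max_lt (mem_Iio.1 ha) hx.1)] with y hy
  obtain ⟨hy1, hyx⟩ := hy
  have hya := (le_max_left _ _).trans_lt hy1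
  have hy0 := (le_max_right _ _).trans_lt hy1
  have hW : 0 < P.W x - P.W y := sub_pos.2 (P.W_strictMono hyx)
  have key := abs_setIntegral_sub_le (μ := P.mW) (s := Ioc y x) (F := F) (c := F x) (ε := ε / 2)
    hF (fun t ht => by
      rcases eq_or_lt_of_le ht.2 with rfl | h2
      · simpa using (half_pos hε).le
      · exact (hsub ⟨hya.trans ht.1, h2⟩).le)
  rw [P.mW_Ioc hy0.le hyx.le hx.2, ← primW_sub hF hyx.le] at key
  rw [Real.dist_eq, ← neg_sub (P.primW F x), ← neg_sub (P.W x), neg_div_neg_eq,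
    div_sub' hW.ne', abs_div, abs_of_pos hW, div_lt_iff₀ hW, mul_comm (P.W x - P.W y)]
  exact key.trans_lt (by nlinarith)

theorem primV_rightDeriv (hG : Integrable G P.mV) {x : ℝ} (hx : x ∈ Ico (0 : ℝ) 1)
    (h : Tendsto G (𝓝[>] x) (𝓝 (G x))) :
    Tendsto (fun y => (P.primV G y - P.primV G x) / (P.V y - P.V x)) (𝓝[>] x) (𝓝 (G x)) := by
  rw [Metric.tendsto_nhds]
  intro ε hε
  have h1 := (Metric.tendsto_nhds.1 h) (ε / 2) (half_pos hε)
  obtain ⟨a, ha, hsub⟩ := (mem_nhdsGT_iff_exists_Ioo_subset).1 h1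
  filter_upwards [Ioo_mem_nhdsGT (lt_min (mem_Ioi.1 ha) hx.2)] with y hy
  obtain ⟨hyx, hy1⟩ := hy
  have hya := hy1.trans_le (min_le_left _ _)
  have hy0 := hy1.trans_le (min_le_right _ _)
  have hV : 0 < P.V y - P.V x := sub_pos.2 (P.V_strictMono hyx)
  have key := abs_setIntegral_sub_le (μ := P.mV) (s := Ico x y) (F := G) (c := G x) (ε := ε / 2)
    hG (fun t ht => by
      rcases eq_or_lt_of_le ht.1 with rfl | h2
      · simpa using (half_pos hε).le
      · exact (hsub ⟨h2, ht.2.trans hya⟩).le)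
  rw [P.mV_Ico hx.1 hyx.le hy0.le, ← primV_sub hG hyx.le] at key
  rw [Real.dist_eq, div_sub' hV.ne', abs_div, abs_of_pos hV, div_lt_iff₀ hV,
    mul_comm (P.V y - P.V x)]
  exact key.trans_lt (by nlinarith)

/-! ### The fundamental theorem of calculus for lateral derivatives -/

/-- Real induction from `b` leftwards. Right-continuity gives the bound at the infimum `s` of the
good starting points, and the left-sided hypothesis would carry it beyond `s` unless `s = a`. -/
theorem le_of_eventually_le_left {h : ℝ → ℝ} {a b : ℝ} (hab : a ≤ b)
    (hr : ∀ x ∈ Ico a b, Tendsto h (𝓝[>] x) (𝓝 (h x)))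
    (hl : ∀ x ∈ Ioc a b, ∀ᶠ y in 𝓝[<] x, h y ≤ h x) : h a ≤ h b := by
  set S : Set ℝ := {x | x ∈ Icc a b ∧ ∀ y ∈ Icc x b, h y ≤ h b} with hS
  have hbS : b ∈ S := ⟨⟨hab, le_rfl⟩, fun y hy => by rw [le_antisymm hy.2 hy.1]⟩
  have hbdd : BddBelow S := ⟨a, fun x hx => hx.1.1⟩
  set s := sInf S with hs
  have has : a ≤ s := le_csInf ⟨b, hbS⟩ fun x hx => hx.1.1
  have hsb : s ≤ b := csInf_le hbdd hbS
  have hgt : ∀ y ∈ Ioc s b, h y ≤ h b := by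
    intro y hy
    obtain ⟨z, hz, hzy⟩ := exists_lt_of_csInf_lt ⟨b, hbS⟩ hy.1
    exact hz.2 y ⟨hzy.le, hy.2⟩
  have hsle : h s ≤ h b := by
    rcases eq_or_lt_of_le hsb with h1 | h1
    · rw [h1]
    · refine le_of_tendsto (hr s ⟨has, h1⟩) ?_
      filter_upwards [Ioc_mem_nhdsGT h1] with y hy using hgt y hy
  have hsS : ∀ y ∈ Icc s b, h y ≤ h b := by
    intro y hy
    rcases eq_or_lt_of_le hy.1 with rfl | h1
    · exact hsle
    · exact hgt y ⟨h1, hy.2⟩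
  rcases eq_or_lt_of_le has with h1 | h1
  · rw [h1]; exact hsle
  · obtain ⟨c, hc, hsub⟩ := (mem_nhdsLT_iff_exists_Ioo_subset).1 (hl s ⟨h1, hsb⟩)
    obtain ⟨z, hz1, hz2⟩ := exists_between (max_lt (mem_Iio.1 hc) h1)
    have hzS : z ∈ S := by
      refine ⟨⟨((le_max_right _ _).trans_lt hz1).le, hz2.le.trans hsb⟩, fun y hy => ?_⟩
      rcases lt_or_ge y s with h2 | h2
      · exact (hsub ⟨((le_max_left _ _).trans_lt hz1).trans_le hy.1, h2⟩).trans hsle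
      · exact hsS y ⟨h2, hy.2⟩
    exact absurd (csInf_le hbdd hzS) (not_le.2 hz2)

theorem le_of_eventually_le_right {h : ℝ → ℝ} {a b : ℝ} (hab : a ≤ b)
    (hl : ∀ x ∈ Ioc a b, Tendsto h (𝓝[<] x) (𝓝 (h x)))
    (hr : ∀ x ∈ Ico a b, ∀ᶠ y in 𝓝[>] x, h x ≤ h y) : h a ≤ h b := by
  have := le_of_eventually_le_left (h := fun x => -h (-x)) (neg_le_neg hab)
    (fun x hx => ((hl (-x) ⟨by linarith [hx.2], by linarith [hx.1]⟩).comp tendsto_neg_nhdsGT).neg)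
    (fun x hx => by
      have h1 := hr (-x) ⟨by linarith [hx.2], by linarith [hx.1]⟩
      filter_upwards [tendsto_neg_nhdsLT.eventually h1] with y hy
      exact neg_le_neg hy)
  simpa using this

/-- Adding `ε W / W 1` turns the vanishing derivative into the local inequality of
`le_of_eventually_le_left`, at a cost of at most `ε`. Applying this to `k` and `-k` gives equality.
-/
theorem eq_of_leftDeriv_zero {k : ℝ → ℝ}
    (hr : ∀ x ∈ Ico (0 : ℝ) 1, Tendsto k (𝓝[>] x) (𝓝 (k x)))
    (hl : ∀ x ∈ Ioc (0 : ℝ) 1,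
      Tendsto (fun y => (k y - k x) / (P.W y - P.W x)) (𝓝[<] x) (𝓝 0))
    {x : ℝ} (hx : x ∈ Icc (0 : ℝ) 1) : k x = k 0 := by
  have main : ∀ k : ℝ → ℝ, (∀ x ∈ Ico (0 : ℝ) 1, Tendsto k (𝓝[>] x) (𝓝 (k x))) →
      (∀ x ∈ Ioc (0 : ℝ) 1,
        Tendsto (fun y => (k y - k x) / (P.W y - P.W x)) (𝓝[<] x) (𝓝 0)) → k 0 ≤ k x := by
    intro k hr hl
    refine le_of_forall_pos_le_add fun ε hε => ?_
    have h1 := le_of_eventually_le_left (h := fun y => k y + ε / P.W 1 * P.W y) hx.1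
      (fun y hy => (hr y ⟨hy.1, hy.2.trans_le hx.2⟩).add
        (((P.W_rightCont y).tendsto.mono_left (nhdsWithin_mono _ Ioi_subset_Ici_self)).const_mul _))
      (fun y hy => by
        have h2 := (hl y ⟨hy.1, hy.2.trans hx.2⟩).eventually_const_le
          (neg_lt_zero.2 (div_pos hε P.W_one_pos))
        filter_upwards [h2, self_mem_nhdsWithin] with z hz hzy
        rw [le_div_iff_of_neg (sub_neg.2 (P.W_strictMono hzy))] at hz
        linarith)
    simp only [P.W_zero, mul_zero, add_zero] at h1
    refine h1.trans (add_le_add le_rfl ?_)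
    rw [div_mul_eq_mul_div, div_le_iff₀ P.W_one_pos]
    exact mul_le_mul_of_nonneg_left (P.W_strictMono.monotone hx.2) hε.le
  refine le_antisymm ?_ (main k hr hl)
  have := main (fun y => -k y) (fun y hy => (hr y hy).neg) (fun y hy => by
    have := (hl y hy).neg
    rw [neg_zero] at this
    refine this.congr fun z => ?_
    rw [← neg_div]; ring)
  exact neg_le_neg_iff.1 this

theorem eq_of_rightDeriv_zero {k : ℝ → ℝ}
    (hl : ∀ x ∈ Ioc (0 : ℝ) 1, Tendsto k (𝓝[<] x) (𝓝 (k x)))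
    (hr : ∀ x ∈ Ico (0 : ℝ) 1,
      Tendsto (fun y => (k y - k x) / (P.V y - P.V x)) (𝓝[>] x) (𝓝 0))
    {x : ℝ} (hx : x ∈ Icc (0 : ℝ) 1) : k x = k 0 := by
  have main : ∀ k : ℝ → ℝ, (∀ x ∈ Ioc (0 : ℝ) 1, Tendsto k (𝓝[<] x) (𝓝 (k x))) →
      (∀ x ∈ Ico (0 : ℝ) 1,
        Tendsto (fun y => (k y - k x) / (P.V y - P.V x)) (𝓝[>] x) (𝓝 0)) → k 0 ≤ k x := by
    intro k hl hr
    refine le_of_forall_pos_le_add fun ε hε => ?_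
    have h1 := le_of_eventually_le_right (h := fun y => k y + ε / P.V 1 * P.V y) hx.1
      (fun y hy => (hl y ⟨hy.1, hy.2.trans hx.2⟩).add
        (((P.V_leftCont y).tendsto.mono_left (nhdsWithin_mono _ Iio_subset_Iic_self)).const_mul _))
      (fun y hy => by
        have h2 := (hr y ⟨hy.1, hy.2.trans_le hx.2⟩).eventually_const_le
          (neg_lt_zero.2 (div_pos hε P.V_one_pos))
        filter_upwards [h2, self_mem_nhdsWithin] with z hz hzy
        rw [le_div_iff₀ (sub_pos.2 (P.V_strictMono hzy))] at hz
        linarith)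
    simp only [P.V_zero, mul_zero, add_zero] at h1
    refine h1.trans (add_le_add le_rfl ?_)
    rw [div_mul_eq_mul_div, div_le_iff₀ P.V_one_pos]
    exact mul_le_mul_of_nonneg_left (P.V_strictMono.monotone hx.2) hε.le
  refine le_antisymm ?_ (main k hl hr)
  have := main (fun y => -k y) (fun y hy => (hl y hy).neg) (fun y hy => by
    have := (hr y hy).neg
    rw [neg_zero] at this
    refine this.congr fun z => ?_
    rw [← neg_div]; ring)
  exact neg_le_neg_iff.1 this

end

/-! ### Functions on the torus as primitives of their strong derivatives -/

theorem integrable_of_bounded {μ : Measure ℝ} [IsFiniteMeasure μ] {f : UnitAddCircle → ℝ}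
    (hf : Measurable f) (hb : ∃ C, ∀ x, |f x| ≤ C) : Integrable (fun x : ℝ => f x) μ := by
  obtain ⟨C, hC⟩ := hb
  exact Integrable.of_bound (hf.comp measurable_coe_circle).aestronglyMeasurable C
    (Eventually.of_forall fun x => hC x)

theorem eq_add_primW (P : WVPair) {f F : UnitAddCircle → ℝ} (hf : IsCadlag f) (hF : IsCaglad F)
    (h : IsLeftDeriv P.W f F) {x : ℝ} (hx : x ∈ Icc (0 : ℝ) 1) :
    f x = f (0 : ℝ) + P.primW (fun t : ℝ => F t) x := by
  have hi : Integrable (fun x : ℝ => F x) P.mW := integrable_of_bounded hF.measurable hF.bounded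
  have := eq_of_leftDeriv_zero (P := P) (k := fun x : ℝ => f x - P.primW (fun t : ℝ => F t) x)
    (fun y _ => ((isCadlag_iff.1 hf y).1).sub (primW_tendsto_right hi y))
    (fun y hy => by
      have := (h y).sub (primW_leftDeriv hi hy (isCaglad_iff.1 hF y).1)
      rw [sub_self] at this
      exact this.congr fun z => by rw [← sub_div]; ring) hx
  simp only [primW_zero] at this
  linarith

theorem eq_add_primV (P : WVPair) {g G : UnitAddCircle → ℝ} (hg : IsCaglad g) (hG : IsCadlag G)
    (h : IsRightDeriv P.V g G) {x : ℝ} (hx : x ∈ Icc (0 : ℝ) 1) :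
    g x = g (0 : ℝ) + P.primV (fun t : ℝ => G t) x := by
  have hi : Integrable (fun x : ℝ => G x) P.mV := integrable_of_bounded hG.measurable hG.bounded
  have := eq_of_rightDeriv_zero (P := P) (k := fun x : ℝ => g x - P.primV (fun t : ℝ => G t) x)
    (fun y _ => ((isCaglad_iff.1 hg y).1).sub (primV_tendsto_left hi y))
    (fun y hy => by
      have := (h y).sub (primV_rightDeriv hi hy (isCadlag_iff.1 hG y).1)
      rw [sub_self] at this
      exact this.congr fun z => by rw [← sub_div]; ring) hx
  simp only [primV_zero] at this
  linarith

/-! ### Integration by parts -/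

/-- Fubini on the triangle `t ≤ x`: since `G` has mean zero, its integral over `x ≥ t` is `-primV G
t`. Points with `x = t` are counted once, so common atoms leave no correction term. -/
theorem integral_primW_mul (P : WVPair) {F G : ℝ → ℝ} (hF : Integrable F P.mW)
    (hG : Integrable G P.mV) (hG0 : ∫ x, G x ∂P.mV = 0) :
    ∫ x, P.primW F x * G x ∂P.mV = -∫ t, F t * P.primV G t ∂P.mW := by
  have hint : Integrable (fun z : ℝ × ℝ => {z : ℝ × ℝ | z.2 ≤ z.1}.indicator
      (fun z => G z.1 * F z.2) z) (P.mV.prod P.mW) :=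
    (hG.mul_prod hF).indicator (measurableSet_le measurable_snd measurable_fst)
  have hsw := integral_integral_swap (f := fun x t => {z : ℝ × ℝ | z.2 ≤ z.1}.indicator
      (fun z => G z.1 * F z.2) (x, t)) hint
  have e1 : ∀ x, ∫ t, {z : ℝ × ℝ | z.2 ≤ z.1}.indicator (fun z => G z.1 * F z.2) (x, t) ∂P.mW =
      P.primW F x * G x := by
    intro x
    rw [primW, mul_comm, ← integral_const_mul, ← integral_indicator measurableSet_Iic]
    rfl
  have e2 : ∀ t, ∫ x, {z : ℝ × ℝ | z.2 ≤ z.1}.indicator (fun z => G z.1 * F z.2) (x, t) ∂P.mV =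
      -(F t * P.primV G t) := by
    intro t
    have h1 : ∫ x in Ici t, G x ∂P.mV = -P.primV G t := by
      have := integral_add_compl (measurableSet_Iio (a := t)) hG
      rw [hG0, compl_Iio] at this
      rw [primV]; linarith
    rw [← mul_neg, ← h1, ← integral_const_mul, ← integral_indicator measurableSet_Ici]
    refine integral_congr_ae (Eventually.of_forall fun x => ?_)
    by_cases hx : t ≤ x <;> simp [indicator, hx, mul_comm]
  simp_rw [e1, e2] at hsw
  rw [hsw, integral_neg]

theorem measurable_primW {P : WVPair} {F : ℝ → ℝ} (hF : Integrable F P.mW) :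
    Measurable (P.primW F) :=
  measurable_of_tendsto_nhdsGT fun x => primW_tendsto_right hF x

theorem measurable_primV {P : WVPair} {G : ℝ → ℝ} (hG : Integrable G P.mV) :
    Measurable (P.primV G) :=
  measurable_of_tendsto_nhdsLT fun x => primV_tendsto_left hG x

theorem norm_primW_le {P : WVPair} {F : ℝ → ℝ} (hF : Integrable F P.mW) (x : ℝ) :
    ‖P.primW F x‖ ≤ ∫ t, ‖F t‖ ∂P.mW :=
  (norm_integral_le_integral_norm _).trans
    (setIntegral_le_integral hF.norm (Eventually.of_forall fun _ => norm_nonneg _))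

theorem norm_primV_le {P : WVPair} {G : ℝ → ℝ} (hG : Integrable G P.mV) (x : ℝ) :
    ‖P.primV G x‖ ≤ ∫ t, ‖G t‖ ∂P.mV :=
  (norm_integral_le_integral_norm _).trans
    (setIntegral_le_integral hG.norm (Eventually.of_forall fun _ => norm_nonneg _))

/-- Integration by parts: if `f` is a primitive of `F` and `g` a primitive of `G`, both periodic,
then `∫ f G dV = -∫ F g dW`. -/
theorem integral_mul_eq_neg (P : WVPair) {f F g G : ℝ → ℝ} {c d : ℝ} (hF : Integrable F P.mW)
    (hG : Integrable G P.mV) (hF0 : ∫ x, F x ∂P.mW = 0) (hG0 : ∫ x, G x ∂P.mV = 0)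
    (hf : ∀ᵐ x ∂P.mV, f x = c + P.primW F x) (hg : ∀ᵐ x ∂P.mW, g x = d + P.primV G x) :
    ∫ x, f x * G x ∂P.mV = -∫ x, F x * g x ∂P.mW := by
  have h1 : ∫ x, f x * G x ∂P.mV = ∫ x, P.primW F x * G x ∂P.mV := by
    rw [integral_congr_ae (g := fun x => c * G x + P.primW F x * G x)
      (hf.mono fun x hx => by simp only [hx]; ring), integral_add (hG.const_mul c)
      (hG.bdd_mul (measurable_primW hF).aestronglyMeasurable
        (Eventually.of_forall (norm_primW_le hF))), integral_const_mul, hG0]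
    simp
  have h2 : ∫ x, F x * g x ∂P.mW = ∫ x, F x * P.primV G x ∂P.mW := by
    rw [integral_congr_ae (g := fun x => F x * d + F x * P.primV G x)
      (hg.mono fun x hx => by simp only [hx]; ring), integral_add (hF.mul_const d)
      (hF.mul_bdd (measurable_primV hG).aestronglyMeasurable
        (Eventually.of_forall (norm_primV_le hG))), integral_mul_const, hF0]
    simp
  rw [h1, h2, P.integral_primW_mul hF hG hG0]

/-! ### A function with constant primitive vanishes -/

/-- The sets over which `F` integrates to zero are closed under complements, thanks to `h0`, and
disjoint unions, so a generating π-system suffices. -/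
theorem ae_eq_zero_of_forall_setIntegral_pi {μ : Measure ℝ} {F : ℝ → ℝ} (hF : Integrable F μ)
    {C : Set (Set ℝ)} (hC : borel ℝ = MeasurableSpace.generateFrom C) (hpi : IsPiSystem C)
    (h0 : ∫ x, F x ∂μ = 0) (h : ∀ s ∈ C, ∫ x in s, F x ∂μ = 0) : F =ᵐ[μ] 0 := by
  refine hF.ae_eq_zero_of_forall_setIntegral_eq_zero fun s hs hfin => ?_
  clear hfin
  induction s, hs using MeasurableSpace.induction_on_inter hC hpi with
  | empty => simp
  | basic t ht => exact h t ht
  | compl t ht ih =>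
    have := integral_add_compl ht hF
    rw [h0, ih] at this
    linarith
  | iUnion f hd hm ih =>
    rw [integral_iUnion hm hd hF.integrableOn]
    simp [ih]

/-- Strict monotonicity of `V` gives every right neighbourhood positive mass, so it meets each set
of full measure. -/
theorem frequently_nhdsGT_of_ae (P : WVPair) {p : ℝ → Prop} (h : ∀ᵐ x ∂P.mV, p x) {x : ℝ}
    (hx : x ∈ Ico (0 : ℝ) 1) : ∃ᶠ y in 𝓝[>] x, p y := by
  intro hn
  obtain ⟨b, hb, hsub⟩ := (mem_nhdsGT_iff_exists_Ioo_subset).1 hn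
  obtain ⟨m, hm1, hm2⟩ := exists_between (lt_min (mem_Ioi.1 hb) hx.2)
  have h1 : P.mV.real (Ico m (min b 1)) = 0 := by
    rw [measureReal_eq_zero_iff]
    refine measure_mono_null (fun y hy => ?_) (ae_iff.1 h)
    exact hsub ⟨hm1.trans_le hy.1, hy.2.trans_le (min_le_left _ _)⟩
  rw [P.mV_Ico (hx.1.trans hm1.le) hm2.le (min_le_right _ _)] at h1
  exact absurd (P.V_strictMono hm2) (by linarith)

theorem frequently_nhdsLT_of_ae (P : WVPair) {p : ℝ → Prop} (h : ∀ᵐ x ∂P.mW, p x) {x : ℝ}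
    (hx : x ∈ Ioc (0 : ℝ) 1) : ∃ᶠ y in 𝓝[<] x, p y := by
  intro hn
  obtain ⟨b, hb, hsub⟩ := (mem_nhdsLT_iff_exists_Ioo_subset).1 hn
  obtain ⟨m, hm1, hm2⟩ := exists_between (max_lt (mem_Iio.1 hb) hx.1)
  have h1 : P.mW.real (Ioc (max b 0) m) = 0 := by
    rw [measureReal_eq_zero_iff]
    refine measure_mono_null (fun y hy => ?_) (ae_iff.1 h)
    exact hsub ⟨(le_max_left _ _).trans_lt hy.1, hy.2.trans_lt hm2⟩
  rw [P.mW_Ioc (le_max_right _ _) hm1.le (hm2.le.trans hx.2)] at h1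
  exact absurd (P.W_strictMono hm1) (by linarith)

theorem eq_of_tendsto_of_frequently_eq {l : Filter ℝ} {f : ℝ → ℝ} {a c : ℝ}
    (h : Tendsto f l (𝓝 a)) (hf : ∃ᶠ y in l, f y = c) : a = c := by
  by_contra hne
  exact hf (h.eventually_ne hne)

/-- Right-continuity upgrades the a.e. identity to all of `[0, 1)`; the value at 0 forces `c = 0`,
and half-lines generate the Borel sets. -/
theorem ae_eq_zero_of_primW_eq_const (P : WVPair) {F : ℝ → ℝ} (hF : Integrable F P.mW)
    (h0 : ∫ x, F x ∂P.mW = 0) {c : ℝ} (h : ∀ᵐ x ∂P.mV, P.primW F x = c) : F =ᵐ[P.mW] 0 := by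
  have h1 : ∀ x ∈ Ico (0 : ℝ) 1, P.primW F x = c := fun x hx =>
    eq_of_tendsto_of_frequently_eq (primW_tendsto_right hF x) (P.frequently_nhdsGT_of_ae h hx)
  have hc : c = 0 := by rw [← h1 0 (by simp), primW_zero]
  refine ae_eq_zero_of_forall_setIntegral_pi hF (borel_eq_generateFrom_Iic ℝ) isPiSystem_Iic h0 ?_
  rintro _ ⟨a, rfl⟩
  rcases le_or_gt a 0 with ha | ha
  · exact setIntegral_measure_zero _ (measure_mono_null (Iic_subset_Iic.2 ha) P.mW_Iic_zero)
  rcases lt_or_ge a 1 with ha1 | ha1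
  · exact (h1 a ⟨ha.le, ha1⟩).trans hc
  · rw [← h0, ← setIntegral_univ (f := F) (μ := P.mW)]
    refine setIntegral_congr_set (μ := P.mW) ?_
    filter_upwards [P.ae_mW_mem] with x hx
    exact propext ⟨fun _ => trivial, fun _ => hx.2.trans ha1⟩

/-- Left-continuity reaches `(0, 1]`, so the constant is now read off at 1, where the primitive is
the total integral. -/
theorem ae_eq_zero_of_primV_eq_const (P : WVPair) {G : ℝ → ℝ} (hG : Integrable G P.mV)
    (h0 : ∫ x, G x ∂P.mV = 0) {c : ℝ} (h : ∀ᵐ x ∂P.mW, P.primV G x = c) : G =ᵐ[P.mV] 0 := by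
  have h1 : ∀ x ∈ Ioc (0 : ℝ) 1, P.primV G x = c := fun x hx =>
    eq_of_tendsto_of_frequently_eq (primV_tendsto_left hG x) (P.frequently_nhdsLT_of_ae h hx)
  have hc : c = 0 := by rw [← h1 1 (by simp), primV_one, h0]
  refine ae_eq_zero_of_forall_setIntegral_pi hG (borel_eq_generateFrom_Iio ℝ) isPiSystem_Iio h0 ?_
  rintro _ ⟨a, rfl⟩
  rcases le_or_gt a 0 with ha | ha
  · exact setIntegral_measure_zero _ (measure_mono_null (Iio_subset_Iic_self.trans
      (Iic_subset_Iic.2 ha)) P.mV_Iic_zero)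
  rcases le_or_gt a 1 with ha1 | ha1
  · exact (h1 a ⟨ha, ha1⟩).trans hc
  · rw [← h0, ← setIntegral_univ (f := G) (μ := P.mV)]
    refine setIntegral_congr_set (μ := P.mV) ?_
    filter_upwards [P.ae_mV_mem] with x hx
    exact propext ⟨fun _ => trivial, fun _ => hx.2.trans_lt ha1⟩

/-! ### Levels -/

/-- Càdlàg at even levels, càglàd at odd levels. -/
def IsLim : ℕ → (UnitAddCircle → ℝ) → Prop
  | 0, f => IsCadlag f
  | 1, f => IsCaglad f
  | n + 2, f => IsLim n f

theorem memC_iff (P : WVPair) : ∀ {n : ℕ} {f : UnitAddCircle → ℝ},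
    P.MemC n f ↔ IsLim n f ∧ ∫ x, f x ∂(P.meas n) = 0
  | 0, _ => Iff.rfl
  | 1, _ => Iff.rfl
  | n + 2, _ => P.memC_iff (n := n)

theorem IsLim.measurable : ∀ {n : ℕ} {f : UnitAddCircle → ℝ}, IsLim n f → Measurable f
  | 0, _, h => IsCadlag.measurable h
  | 1, _, h => IsCaglad.measurable h
  | n + 2, _, h => IsLim.measurable (n := n) h

theorem IsLim.bounded : ∀ {n : ℕ} {f : UnitAddCircle → ℝ}, IsLim n f → ∃ C, ∀ x, |f x| ≤ C
  | 0, _, h => IsCadlag.bounded h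
  | 1, _, h => IsCaglad.bounded h
  | n + 2, _, h => IsLim.bounded (n := n) h

/-- The combination `f + c g` covers sums and multiples at once; the same form is used below for
derivatives and smooth functions. -/
theorem IsLim.add_mul : ∀ {n : ℕ} {f g : UnitAddCircle → ℝ}, IsLim n f → IsLim n g →
    ∀ c : ℝ, IsLim n fun x => f x + c * g x
  | 0, _, _, hf, hg, c => fun x => by
    obtain ⟨h1, l, hl⟩ := hf x
    obtain ⟨h2, m, hm⟩ := hg x
    exact ⟨h1.add (h2.const_mul c), _, hl.add (hm.const_mul c)⟩
  | 1, _, _, hf, hg, c => fun x => by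
    obtain ⟨h1, l, hl⟩ := hf x
    obtain ⟨h2, m, hm⟩ := hg x
    exact ⟨h1.add (h2.const_mul c), _, hl.add (hm.const_mul c)⟩
  | n + 2, _, _, hf, hg, c => IsLim.add_mul (n := n) hf hg c

theorem isLim_const : ∀ (n : ℕ) (c : ℝ), IsLim n fun _ => c
  | 0, _ => fun _ => ⟨continuousWithinAt_const, _, tendsto_const_nhds⟩
  | 1, _ => fun _ => ⟨continuousWithinAt_const, _, tendsto_const_nhds⟩
  | n + 2, c => isLim_const n c

theorem IsLim.const_mul {n : ℕ} {f : UnitAddCircle → ℝ} (hf : IsLim n f) (c : ℝ) :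
    IsLim n fun x => c * f x := by
  simpa using (isLim_const n 0).add_mul hf c

theorem IsLim.memLp (P : WVPair) {n : ℕ} {f : UnitAddCircle → ℝ} (hf : IsLim n f) (m : ℕ) :
    MemLp f 2 (P.meas m) := by
  obtain ⟨C, hC⟩ := hf.bounded
  exact MemLp.of_bound hf.measurable.aestronglyMeasurable C (Eventually.of_forall hC)

theorem IsLim.integrable (P : WVPair) {n : ℕ} {f : UnitAddCircle → ℝ} (hf : IsLim n f) (m : ℕ) :
    Integrable f (P.meas m) :=
  (hf.memLp P m).integrable one_le_two

theorem IsDeriv.add_mul (P : WVPair) : ∀ {n : ℕ} {f g f' g' : UnitAddCircle → ℝ},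
    P.IsDeriv n f f' → P.IsDeriv n g g' → ∀ c : ℝ,
      P.IsDeriv n (fun x => f x + c * g x) (fun x => f' x + c * g' x)
  | 0, _, _, _, _, hf, hg, c => fun x => ((hf x).add ((hg x).const_mul c)).congr fun y => by ring
  | 1, _, _, _, _, hf, hg, c => fun x => ((hf x).add ((hg x).const_mul c)).congr fun y => by ring
  | n + 2, _, _, _, _, hf, hg, c => IsDeriv.add_mul P (n := n) hf hg c

theorem isDeriv_const (P : WVPair) : ∀ (n : ℕ) (c : ℝ), P.IsDeriv n (fun _ => c) fun _ => 0
  | 0, _ => fun x => by simp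
  | 1, _ => fun x => by simp
  | n + 2, c => isDeriv_const P n c

theorem IsDeriv.const_mul (P : WVPair) {n : ℕ} {f f' : UnitAddCircle → ℝ}
    (hf : P.IsDeriv n f f') (c : ℝ) : P.IsDeriv n (fun x => c * f x) fun x => c * f' x := by
  simpa using IsDeriv.add_mul P (isDeriv_const P n 0) hf c

theorem IsDeriv.unique (P : WVPair) : ∀ {n : ℕ} {f g g' : UnitAddCircle → ℝ},
    P.IsDeriv n f g → P.IsDeriv n f g' → g = g'
  | 0, _, _, _, h, h' => funext fun x => by
      obtain ⟨x, rfl⟩ := QuotientAddGroup.mk_surjective x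
      exact tendsto_nhds_unique (h x) (h' x)
  | 1, _, _, _, h, h' => funext fun x => by
      obtain ⟨x, rfl⟩ := QuotientAddGroup.mk_surjective x
      exact tendsto_nhds_unique (h x) (h' x)
  | n + 2, _, _, _, h, h' => IsDeriv.unique P (n := n) h h'

theorem integral_meas_of_measurable (P : WVPair) (n : ℕ) {f : UnitAddCircle → ℝ}
    (hf : Measurable f) : ∫ x, f x ∂(P.meas n) = ∫ x, f (x : ℝ) ∂(P.mI n) :=
  P.integral_meas hf.aestronglyMeasurable

/-- The total integral of the derivative is the difference of `f` at the identified points 1 and 0.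
-/
theorem integral_isDeriv_zero (P : WVPair) {f F : UnitAddCircle → ℝ} (hf : IsCadlag f)
    (hF : IsCaglad F) (h : IsLeftDeriv P.W f F) : ∫ x, F (x : ℝ) ∂P.mW = 0 := by
  have := P.eq_add_primW hf hF h (x := 1) (by simp)
  rw [coe_one_eq, primW_one] at this
  linarith

theorem integral_isDeriv_one (P : WVPair) {f F : UnitAddCircle → ℝ} (hf : IsCaglad f)
    (hF : IsCadlag F) (h : IsRightDeriv P.V f F) : ∫ x, F (x : ℝ) ∂P.mV = 0 := by
  have := P.eq_add_primV hf hF h (x := 1) (by simp)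
  rw [coe_one_eq, primV_one] at this
  linarith

theorem integral_isDeriv (P : WVPair) : ∀ {n : ℕ} {f F : UnitAddCircle → ℝ}, IsLim n f →
    IsLim (n + 1) F → P.IsDeriv n f F → ∫ x, F x ∂(P.meas (n + 1)) = 0
  | 0, _, _, hf, hF, h => by
    rw [P.integral_meas_of_measurable _ hF.measurable]; exact P.integral_isDeriv_zero hf hF h
  | 1, _, _, hf, hF, h => by
    rw [P.integral_meas_of_measurable _ hF.measurable]; exact P.integral_isDeriv_one hf hF h
  | n + 2, _, _, hf, hF, h => P.integral_isDeriv (n := n) hf hF h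

theorem integral_mul_deriv_zero (P : WVPair) {f F g G : UnitAddCircle → ℝ} (hf : IsCadlag f)
    (hF : IsCaglad F) (hg : IsCaglad g) (hG : IsCadlag G) (hfF : IsLeftDeriv P.W f F)
    (hgG : IsRightDeriv P.V g G) :
    ∫ x, f x * G x ∂(P.meas 0) = -∫ x, F x * g x ∂(P.meas 1) := by
  rw [P.integral_meas_of_measurable _ (f := fun x => f x * G x) (hf.measurable.mul hG.measurable),
    P.integral_meas_of_measurable _ (f := fun x => F x * g x) (hF.measurable.mul hg.measurable)]
  refine P.integral_mul_eq_neg (c := f (0 : ℝ)) (d := g (0 : ℝ))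
    (integrable_of_bounded hF.measurable hF.bounded)
    (integrable_of_bounded hG.measurable hG.bounded) (P.integral_isDeriv_zero hf hF hfF)
    (P.integral_isDeriv_one hg hG hgG) ?_ ?_
  · filter_upwards [P.ae_mV_mem] with x hx
    exact P.eq_add_primW hf hF hfF ⟨hx.1.le, hx.2⟩
  · filter_upwards [P.ae_mW_mem] with x hx
    exact P.eq_add_primV hg hG hgG ⟨hx.1.le, hx.2⟩

/-- Integration by parts for strong derivatives. -/
theorem integral_mul_deriv (P : WVPair) : ∀ {n : ℕ} {f F g G : UnitAddCircle → ℝ}, IsLim n f →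
    IsLim (n + 1) F → IsLim (n + 1) g → IsLim n G → P.IsDeriv n f F → P.IsDeriv (n + 1) g G →
    ∫ x, f x * G x ∂(P.meas n) = -∫ x, F x * g x ∂(P.meas (n + 1))
  | 0, _, _, _, _, hf, hF, hg, hG, hfF, hgG => P.integral_mul_deriv_zero hf hF hg hG hfF hgG
  | 1, f, F, g, G, hf, hF, hg, hG, hfF, hgG => by
    -- At odd levels `W` and `V` exchange roles, so the even-level identity is applied with the two
    -- pairs swapped.
    have := P.integral_mul_deriv_zero hg hG hf hF hgG hfF
    change ∫ x, f x * G x ∂(P.meas 1) = -∫ x, F x * g x ∂(P.meas 0)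
    simp_rw [mul_comm (f _), mul_comm (F _)]
    linarith
  | n + 2, _, _, _, _, hf, hF, hg, hG, hfF, hgG =>
    P.integral_mul_deriv (n := n) hf hF hg hG hfF hgG

/-! ### The Laplacian in terms of primitives -/

theorem integrable_coe_L2 (P : WVPair) {n : ℕ} (f : P.L2 n) :
    Integrable (fun x : ℝ => f (x : UnitAddCircle)) (P.mI n) :=
  P.integrable_meas ((Lp.memLp f).integrable one_le_two)

theorem integral_coe_L2 (P : WVPair) {n : ℕ} (f : P.L2 n) :
    ∫ x, f x ∂(P.meas n) = ∫ x : ℝ, f (x : UnitAddCircle) ∂(P.mI n) :=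
  P.integral_meas (Lp.aestronglyMeasurable f)

theorem primV_eq (P : WVPair) (G : ℝ → ℝ) {y : ℝ} (hy : y ≤ 1) :
    P.primV G y = ∫ s in Ico 0 y, G s ∂P.dV := by
  rw [primV, mV, Measure.restrict_restrict measurableSet_Iio]
  refine setIntegral_congr_set ?_
  filter_upwards [compl_mem_ae_iff.2 P.dV_singleton_zero] with x hx
  refine propext ⟨fun h => ⟨h.2.1.le, h.1⟩, fun h => ⟨h.2, ?_, h.2.le.trans hy⟩⟩
  exact lt_of_le_of_ne h.1 (Ne.symm hx)

theorem primW_eq (P : WVPair) (F : ℝ → ℝ) {x : ℝ} (hx : x ≤ 1) :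
    P.primW F x = ∫ s in Ioc 0 x, F s ∂P.dW := by
  rw [primW, mW, Measure.restrict_restrict measurableSet_Iic]
  congr 2
  ext t
  exact ⟨fun h => ⟨h.2.1, h.1⟩, fun h => ⟨h.2, h.1, h.2.trans hx⟩⟩

theorem integrable_primV {P : WVPair} {G : ℝ → ℝ} (hG : Integrable G P.mV) :
    Integrable (P.primV G) P.mW :=
  Integrable.of_bound (measurable_primV hG).aestronglyMeasurable _
    (Eventually.of_forall (norm_primV_le hG))

theorem primW_const_add {P : WVPair} {F : ℝ → ℝ} (hF : Integrable F P.mW) (b : ℝ) {x : ℝ}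
    (hx : x ∈ Icc (0 : ℝ) 1) : P.primW (fun y => b + F y) x = P.W x * b + P.primW F x := by
  have h : P.mW.real (Iic x) = P.W x := by
    rw [← sub_zero (P.W x), ← P.W_zero, ← P.mW_Ioc le_rfl hx.1 hx.2]
    refine measureReal_congr ?_
    filter_upwards [P.ae_mW_mem] with t ht
    exact propext ⟨fun h => ⟨ht.1, h⟩, fun h => h.2⟩
  rw [primW, integral_add (integrable_const b) hF.integrableOn, primW]
  simp [h]

/-- The linear term `b W` is absorbed into the integrand, so that `f` is `a` plus a single
`dW`-primitive. -/
theorem isLaplacian_iff (P : WVPair) {f u : P.L2 0} : P.IsLaplacian f u ↔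
    ∫ x : ℝ, u (x : UnitAddCircle) ∂P.mV = 0 ∧ ∃ a b : ℝ,
      ∫ y, (b + P.primV (fun s : ℝ => u (s : UnitAddCircle)) y) ∂P.mW = 0 ∧
      ∀ᵐ x : ℝ ∂P.mV, f (x : UnitAddCircle) =
        a + P.primW (fun y => b + P.primV (fun s : ℝ => u (s : UnitAddCircle)) y) x := by
  have hu : Integrable (fun s : ℝ => u (s : UnitAddCircle)) P.mV := P.integrable_coe_L2 u
  have h1 : ∀ x ≤ (1 : ℝ), ∫ y in Ioc (0 : ℝ) x, (∫ s in Ico (0 : ℝ) y,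
      u (s : UnitAddCircle) ∂P.dV) ∂P.dW =
      P.primW (P.primV (fun s : ℝ => u (s : UnitAddCircle))) x := by
    intro x hx
    rw [primW_eq P _ hx]
    refine setIntegral_congr_fun measurableSet_Ioc fun y hy => ?_
    exact (P.primV_eq _ (hy.2.trans hx)).symm
  rw [IsLaplacian, P.integral_coe_L2 u]
  refine and_congr Iff.rfl (exists_congr fun a => exists_congr fun b => and_congr ?_ ?_)
  · rw [h1 1 le_rfl, ← primW_one, primW_const_add (integrable_primV hu) b (by simp), mul_comm]
  · change (∀ᵐ x ∂P.mV, _) ↔ _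
    refine eventually_congr ?_
    filter_upwards [P.ae_mV_mem] with x hx
    rw [h1 x hx.2, primW_const_add (integrable_primV hu) b ⟨hx.1.le, hx.2⟩, add_assoc]

/-! ### Lifting functions with equal end values to the torus -/

theorem eventually_lift_eq_right {f : ℝ → ℝ} (h : f 0 = f 1) {x : ℝ} (hx : x ∈ Ico (0 : ℝ) 1) :
    ∀ᶠ y : ℝ in 𝓝[>] x, f y = lift f (y : UnitAddCircle) := by
  filter_upwards [Ioo_mem_nhdsGT hx.2] with y hy
  exact (lift_coe h ⟨hx.1.trans hy.1.le, hy.2.le⟩).symm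

theorem eventually_lift_eq_left {f : ℝ → ℝ} (h : f 0 = f 1) {x : ℝ} (hx : x ∈ Ioc (0 : ℝ) 1) :
    ∀ᶠ y : ℝ in 𝓝[<] x, f y = lift f (y : UnitAddCircle) := by
  filter_upwards [Ioo_mem_nhdsLT hx.1] with y hy
  exact (lift_coe h ⟨hy.1.le, hy.2.le.trans hx.2⟩).symm

theorem isCadlag_lift {f : ℝ → ℝ} (h : f 0 = f 1) (h1 : ∀ x, Tendsto f (𝓝[>] x) (𝓝 (f x)))
    (h2 : ∀ x, ∃ l : ℝ, Tendsto f (𝓝[<] x) (𝓝 l)) : IsCadlag (lift f) := by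
  refine isCadlag_of (fun x hx => ?_) fun x hx => ?_
  · rw [lift_coe h ⟨hx.1, hx.2.le⟩]
    exact (h1 x).congr' (eventually_lift_eq_right h hx)
  · exact (h2 x).imp fun l hl => hl.congr' (eventually_lift_eq_left h hx)

theorem isCaglad_lift {f : ℝ → ℝ} (h : f 0 = f 1) (h1 : ∀ x, Tendsto f (𝓝[<] x) (𝓝 (f x)))
    (h2 : ∀ x, ∃ l : ℝ, Tendsto f (𝓝[>] x) (𝓝 l)) : IsCaglad (lift f) := by
  refine isCaglad_of (fun x hx => ?_) fun x hx => ?_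
  · rw [lift_coe h ⟨hx.1.le, hx.2⟩]
    exact (h1 x).congr' (eventually_lift_eq_left h hx)
  · exact (h2 x).imp fun l hl => hl.congr' (eventually_lift_eq_right h hx)

theorem primV_congr {P : WVPair} {F G : ℝ → ℝ} (h : F =ᵐ[P.mV] G) : P.primV F = P.primV G :=
  funext fun _ => integral_congr_ae (ae_restrict_of_ae h)

/-- Eigenfunctions of the Laplacian have representatives that solve the eigenvalue equation in the
strong sense. -/
theorem IsLaplacian.exists_strong {P : WVPair} {f : P.L2 0} {c : ℝ}
    (h : P.IsLaplacian f (-(c • f))) : ∃ φ ψ : UnitAddCircle → ℝ, IsCadlag φ ∧ IsCaglad ψ ∧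
      IsLeftDeriv P.W φ ψ ∧ IsRightDeriv P.V ψ (fun x => -c * φ x) ∧ f =ᵐ[P.meas 0] φ := by
  obtain ⟨h0, a, b, hab, hf⟩ := P.isLaplacian_iff.1 h
  set u : ℝ → ℝ := fun s => (-(c • f) : P.L2 0) (s : UnitAddCircle) with hu
  have hui : Integrable u P.mV := P.integrable_coe_L2 _
  set F : ℝ → ℝ := fun y => b + P.primV u y with hF
  have hFi : Integrable F P.mW := (integrable_const b).add (integrable_primV hui)
  set g : ℝ → ℝ := fun x => a + P.primW F x with hg
  -- Mean zero of `u` closes up the inner primitive and the condition on `b` the outer one, so both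
  -- descend to the torus.
  have hF01 : F 0 = F 1 := by simp only [hF, primV_zero, primV_one, h0]
  have hg01 : g 0 = g 1 := by simp only [hg, primW_zero, primW_one, hab]
  have hφ : IsCadlag (lift g) := isCadlag_lift hg01
    (fun x => (primW_tendsto_right hFi x).const_add a)
    fun x => ⟨_, (primW_tendsto_left hFi x).const_add a⟩
  have hψ : IsCaglad (lift F) := isCaglad_lift hF01
    (fun x => (primV_tendsto_left hui x).const_add b)
    fun x => ⟨_, (primV_tendsto_right hui x).const_add b⟩
  have hfφ : f =ᵐ[P.meas 0] lift g := by
    refine P.ae_meas_iff.2 ?_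
    change ∀ᵐ x ∂P.mV, _
    filter_upwards [hf, P.ae_mV_mem] with x hx hx1
    rw [hx, lift_coe hg01 ⟨hx1.1.le, hx1.2⟩]
  -- `u` is only an a.e. class; exchanging it for `-c φ`, which is right-continuous everywhere, lets
  -- its primitive be differentiated at every point.
  have huφ : u =ᵐ[P.mV] fun x : ℝ => -c * lift g x := by
    have h1 : (-(c • f) : P.L2 0) =ᵐ[P.meas 0] fun x => -c * lift g x := by
      filter_upwards [Lp.coeFn_neg (c • f), Lp.coeFn_smul c f, hfφ] with x h1 h2 h3
      rw [h1, Pi.neg_apply, h2, Pi.smul_apply, h3, smul_eq_mul, neg_mul]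
    exact P.ae_meas_iff.1 h1
  have hGi : Integrable (fun x : ℝ => -c * lift g x) P.mV := hui.congr huφ
  refine ⟨lift g, lift F, hφ, hψ, P.isLeftDeriv_of fun x hx => ?_, P.isRightDeriv_of fun x hx => ?_,
    hfφ⟩
  · rw [lift_coe hg01 ⟨hx.1.le, hx.2⟩, lift_coe hF01 ⟨hx.1.le, hx.2⟩]
    refine (primW_leftDeriv hFi hx ((primV_tendsto_left hui x).const_add b)).congr' ?_
    filter_upwards [eventually_lift_eq_left hg01 hx] with y hy
    rw [← hy, hg, add_sub_add_left_eq_sub]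
  · rw [lift_coe hF01 ⟨hx.1, hx.2.le⟩]
    refine (primV_rightDeriv hGi hx (((isCadlag_iff.1 hφ x).1).const_mul (-c))).congr' ?_
    filter_upwards [eventually_lift_eq_right hF01 hx] with y hy
    rw [← hy, hF, add_sub_add_left_eq_sub, primV_congr huφ]

/-! ### Systems of smooth eigenfunctions -/

theorem inner_L2 (P : WVPair) {n : ℕ} (f g : P.L2 n) :
    inner ℝ f g = ∫ x, f x * g x ∂(P.meas n) := by
  rw [L2.inner_def]
  refine integral_congr_ae (Eventually.of_forall fun x => ?_)
  simp [mul_comm]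

theorem inner_L2_of_ae (P : WVPair) {n : ℕ} {f g : P.L2 n} {φ γ : UnitAddCircle → ℝ}
    (hf : f =ᵐ[P.meas n] φ) (hg : g =ᵐ[P.meas n] γ) :
    inner ℝ f g = ∫ x, φ x * γ x ∂(P.meas n) := by
  rw [inner_L2]
  refine integral_congr_ae ?_
  filter_upwards [hf, hg] with x h1 h2
  rw [h1, h2]

theorem measureReal_meas_zero (P : WVPair) : (P.meas 0).real univ = P.V 1 := by
  rw [meas_zero, Measure.real, Measure.map_apply measurable_coe_circle MeasurableSet.univ,
    preimage_univ, ← Measure.real, mV_univ]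

theorem measureReal_meas_one (P : WVPair) : (P.meas 1).real univ = P.W 1 := by
  rw [meas_one, Measure.real, Measure.map_apply measurable_coe_circle MeasurableSet.univ,
    preimage_univ, ← Measure.real, mW_univ]

theorem orthonormal_pair {E : Type*} [NormedAddCommGroup E] [InnerProductSpace ℝ E] {v : ℕ → E}
    (hv : Orthonormal ℝ v) (i j : ℕ) : inner ℝ (v i) (v j) = if i = j then 1 else 0 := by
  classical
  exact orthonormal_iff_ite.1 hv i j

/-- Two sequences indexed by the even and the odd levels. -/
def alternate (e₀ e₁ : ℕ → UnitAddCircle → ℝ) : ℕ → ℕ → UnitAddCircle → ℝ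
  | 0 => e₀
  | 1 => e₁
  | n + 2 => alternate e₀ e₁ n

/-- Two Hilbert bases indexed by the even and the odd levels. -/
def alternateBasis (P : WVPair) (E₀ : HilbertBasis ℕ ℝ (P.L2 0)) (E₁ : HilbertBasis ℕ ℝ (P.L2 1)) :
    (n : ℕ) → HilbertBasis ℕ ℝ (P.L2 n)
  | 0 => E₀
  | 1 => E₁
  | n + 2 => alternateBasis P E₀ E₁ n

/-- Hilbert bases `E n` of the spaces `L2 n`, represented by lateral continuous functions `e n i`,
on which the strong derivative acts by `e n i ↦ (-1) ^ n √(lam i) • e (n + 1) i`. -/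
structure IsSystem (P : WVPair) (lam : ℕ → ℝ) (e : ℕ → ℕ → UnitAddCircle → ℝ)
    (E : (n : ℕ) → HilbertBasis ℕ ℝ (P.L2 n)) : Prop where
  lam_zero : lam 0 = 0
  lam_pos : ∀ i, 0 < lam (i + 1)
  lam_mono : Monotone lam
  periodic : ∀ n, e (n + 2) = e n
  isLim : ∀ n i, IsLim n (e n i)
  const : ∀ n, ∃ c, ∀ x, e n 0 x = c
  deriv : ∀ n i, P.IsDeriv n (e n i) fun x => (-1) ^ n * √(lam i) * e (n + 1) i x
  ae : ∀ n i, E n i =ᵐ[P.meas n] e n i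

theorem IsEigenbasis.lam_nonneg {P : WVPair} {ν : ℕ → P.L2 0} {lam : ℕ → ℝ}
    (h : P.IsEigenbasis ν lam) (i : ℕ) : 0 ≤ lam i :=
  h.lam_zero.symm.le.trans (h.lam_mono (Nat.zero_le i))

/-- Strong solutions of `D⁺_V D⁻_W φ = 0` are constant. -/
theorem const_of_deriv_deriv_eq_zero (P : WVPair) {φ ψ : UnitAddCircle → ℝ} (hφ : IsCadlag φ)
    (hψ : IsCaglad ψ) (h1 : IsLeftDeriv P.W φ ψ) (h2 : IsRightDeriv P.V ψ fun _ => 0)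
    (x : UnitAddCircle) : φ x = φ (0 : ℝ) := by
  have hψc : ∀ x ∈ Icc (0 : ℝ) 1, ψ x = ψ (0 : ℝ) := by
    intro x hx
    have h0 : IsCadlag fun _ => (0 : ℝ) := isLim_const 0 0
    rw [P.eq_add_primV hψ h0 h2 hx]
    simp [primV]
  have hψ0 : ψ (0 : ℝ) = 0 := by
    have h3 := P.integral_isDeriv_zero hφ hψ h1
    rw [integral_congr_ae (g := fun _ => ψ (0 : ℝ))
      (P.ae_mW_mem.mono fun x hx => hψc x ⟨hx.1.le, hx.2⟩), integral_const, mW_univ,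
      smul_eq_mul] at h3
    exact (mul_eq_zero.1 h3).resolve_left P.W_one_pos.ne'
  obtain ⟨x, rfl⟩ := QuotientAddGroup.mk_surjective x
  refine forall_of_forall_Ico (p := fun x : ℝ => φ (x : UnitAddCircle) = φ (0 : ℝ))
    (fun x n h => by rwa [coe_add_int]) (fun x hx => ?_) x
  rw [P.eq_add_primW hφ hψ h1 ⟨hx.1, hx.2.le⟩, primW, setIntegral_eq_zero_of_ae_eq_zero, add_zero]
  filter_upwards [P.ae_mW_mem] with t ht _
  rw [hψc t ⟨ht.1.le, ht.2⟩, hψ0]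

/-- Orthogonality and completeness of the derivatives of a complete system of eigenfunctions. -/
theorem IsEigenbasis.exists_system {P : WVPair} {ν : ℕ → P.L2 0} {lam : ℕ → ℝ}
    (h : P.IsEigenbasis ν lam) : ∃ e E, P.IsSystem lam e E ∧ ∀ i, E 0 i = ν i := by
  choose φ ψ hφ hψ hφψ hψφ hν using fun i => (h.eigen i).exists_strong
  have hconst : ∀ i, lam i = 0 → ∀ x, φ i x = φ i (0 : ℝ) := by
    intro i hi x
    refine P.const_of_deriv_deriv_eq_zero (hφ i) (hψ i) (hφψ i) ?_ x
    have := hψφ i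
    simpa [hi] using this
  have hφφ : ∀ i j, ∫ x, φ i x * φ j x ∂(P.meas 0) = if i = j then 1 else 0 := by
    intro i j
    rw [← P.inner_L2_of_ae (hν i) (hν j), orthonormal_pair h.orthonormal]
  -- A second zero eigenvalue would give two orthogonal unit vectors that are both constant
  -- functions.
  have hpos : ∀ i, 0 < lam (i + 1) := by
    intro i
    refine lt_of_le_of_ne (h.lam_nonneg _) fun h0 => ?_
    have e1 := hφφ 0 0
    have e2 := hφφ (i + 1) (i + 1)
    have e3 := hφφ 0 (i + 1)
    simp only [hconst 0 h.lam_zero, hconst _ h0.symm] at e1 e2 e3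
    simp only [integral_const, smul_eq_mul, if_true, (Nat.succ_ne_zero i).symm, if_false] at e1 e2 e3
    have hV := P.measureReal_meas_zero ▸ P.V_one_pos.ne'
    rcases mul_eq_zero.1 e3 with h3 | h3
    · exact hV h3
    · rcases mul_eq_zero.1 h3 with h4 | h4
      · rw [h4] at e1; simp at e1
      · rw [h4] at e2; simp at e2
  have hψφ' : ∀ i, IsCadlag fun x => -lam i * φ i x := fun i =>
    IsLim.const_mul (n := 0) (hφ i) (-lam i)
  -- One integration by parts reduces the Gram matrix of the `ψ i` to that of the `φ i`, scaled by
  -- `lam j`.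
  have hψψ : ∀ i j, ∫ x, ψ i x * ψ j x ∂(P.meas 1) = if i = j then lam j else 0 := by
    intro i j
    have h1 := P.integral_mul_deriv_zero (hφ i) (hψ i) (hψ j) (hψφ' j) (hφψ i) (hψφ j)
    have h2 : ∀ x, φ i x * (-lam j * φ j x) = -lam j * (φ i x * φ j x) := fun x => by ring
    simp_rw [h2] at h1
    rw [integral_const_mul, hφφ] at h1
    split_ifs at h1 ⊢ <;> linarith
  have hψ0 : ∀ i, ∫ x, ψ i x ∂(P.meas 1) = 0 := fun i =>
    P.integral_isDeriv (n := 0) (hφ i) (hψ i) (hφψ i)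
  -- `φ 0` is constant and contributes no derivative; the normalised constant of `L²_W` takes its
  -- place at index 0.
  set e₁ : ℕ → UnitAddCircle → ℝ := fun i x =>
    if i = 0 then (√(P.W 1))⁻¹ else (√(lam i))⁻¹ * ψ i x with he₁
  have he₁0 : e₁ 0 = fun _ => (√(P.W 1))⁻¹ := by funext x; simp [he₁]
  have he₁s : ∀ i, e₁ (i + 1) = fun x => (√(lam (i + 1)))⁻¹ * ψ (i + 1) x := fun i => by
    funext x; simp [he₁]
  have hlim₁ : ∀ i, IsCaglad (e₁ i) := by
    intro i
    rcases i with _ | i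
    · rw [he₁0]; exact isLim_const 1 _
    · rw [he₁s]; exact IsLim.const_mul (n := 1) (hψ (i + 1)) (√(lam (i + 1)))⁻¹
  have hmem : ∀ i, MemLp (e₁ i) 2 (P.meas 1) := fun i => IsLim.memLp P (n := 1) (hlim₁ i) 1
  set E₁ : ℕ → P.L2 1 := fun i => (hmem i).toLp with hE₁
  have hE₁ae : ∀ i, E₁ i =ᵐ[P.meas 1] e₁ i := fun i => (hmem i).coeFn_toLp
  have horth : Orthonormal ℝ E₁ := by
    rw [orthonormal_iff_ite]
    intro i j
    rw [P.inner_L2_of_ae (hE₁ae i) (hE₁ae j)]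
    rcases i with _ | i <;> rcases j with _ | j
    · simp only [he₁0, integral_const, measureReal_meas_one, smul_eq_mul, if_true]
      rw [← mul_inv, Real.mul_self_sqrt P.W_one_pos.le, mul_inv_cancel₀ P.W_one_pos.ne']
    · simp only [he₁0, he₁s, integral_const_mul, hψ0, mul_zero]
      simp
    · simp only [he₁0, he₁s, integral_mul_const, integral_const_mul, hψ0, mul_zero, zero_mul]
      simp
    · have h2 : ∀ x, e₁ (i + 1) x * e₁ (j + 1) x = (√(lam (i + 1)))⁻¹ * (√(lam (j + 1)))⁻¹ *
          (ψ (i + 1) x * ψ (j + 1) x) := fun x => by rw [he₁s, he₁s]; ring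
      simp_rw [h2]
      rw [integral_const_mul, hψψ]
      split_ifs with hij
      · obtain rfl : i = j := Nat.succ_injective hij
        rw [← mul_inv, Real.mul_self_sqrt (hpos i).le, inv_mul_cancel₀ (hpos i).ne']
      · rw [mul_zero]
  -- If `F` is orthogonal to every `e₁ i`, it has mean zero, so its primitive `w` is periodic. By
  -- parts `w` is orthogonal to every `ν (i + 1)`, hence constant, which forces `F = 0`.
  have hcompl : (Submodule.span ℝ (range E₁))ᗮ = ⊥ := by
    rw [Submodule.eq_bot_iff]
    intro F hF
    have hF' : ∀ i, ∫ x, e₁ i x * F x ∂(P.meas 1) = 0 := fun i => by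
      rw [← P.inner_L2_of_ae (hE₁ae i) (EventuallyEq.refl _ _)]
      exact (Submodule.mem_orthogonal _ _).1 hF _ (Submodule.subset_span ⟨i, rfl⟩)
    have hFi : Integrable (fun x : ℝ => F x) P.mW := P.integrable_coe_L2 F
    have hF0 : ∫ x : ℝ, F x ∂P.mW = 0 := by
      have h1 := hF' 0
      rw [he₁0, integral_const_mul] at h1
      have h2 := (mul_eq_zero.1 h1).resolve_left
        (inv_ne_zero (Real.sqrt_ne_zero'.2 P.W_one_pos))
      rwa [P.integral_coe_L2] at h2
    have hFψ : ∀ i, ∫ x : ℝ, F x * ψ (i + 1) x ∂P.mW = 0 := by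
      intro i
      have h1 := hF' (i + 1)
      simp_rw [he₁s, mul_assoc] at h1
      rw [integral_const_mul] at h1
      have h2 := (mul_eq_zero.1 h1).resolve_left
        (inv_ne_zero (Real.sqrt_ne_zero'.2 (hpos i)))
      rw [P.integral_meas (f := fun x => ψ (i + 1) x * F x) ((hψ (i + 1)).measurable.aestronglyMeasurable.mul
        (Lp.aestronglyMeasurable F))] at h2
      simp_rw [mul_comm (F _)]
      exact h2
    set w : ℝ → ℝ := P.primW fun x : ℝ => F x with hw
    have hw01 : w 0 = w 1 := by rw [hw, primW_zero, primW_one, hF0]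
    have hwc : IsCadlag (lift w) := isCadlag_lift hw01 (primW_tendsto_right hFi)
      fun x => ⟨_, primW_tendsto_left hFi x⟩
    have hwm : MemLp (lift w) 2 (P.meas 0) := IsLim.memLp P (n := 0) hwc 0
    have hwν : ∀ i, inner ℝ (ν (i + 1)) hwm.toLp = 0 := by
      intro i
      rw [P.inner_L2_of_ae (hν _) hwm.coeFn_toLp,
        P.integral_meas_of_measurable _ (f := fun x => φ (i + 1) x * lift w x)
          ((hφ _).measurable.mul hwc.measurable)]
      have h1 := P.integral_mul_eq_neg (f := w) (F := fun x : ℝ => F x)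
        (g := fun x : ℝ => ψ (i + 1) x) (G := fun x : ℝ => -lam (i + 1) * φ (i + 1) x) (c := 0)
        (d := ψ (i + 1) (0 : ℝ)) hFi
        (integrable_of_bounded (hψφ' (i + 1)).measurable (hψφ' (i + 1)).bounded) hF0
        (P.integral_isDeriv_one (hψ _) (hψφ' _) (hψφ _))
        (Eventually.of_forall fun x => by rw [zero_add])
        (P.ae_mW_mem.mono fun x hx => P.eq_add_primV (hψ _) (hψφ' _) (hψφ _) ⟨hx.1.le, hx.2⟩)
      rw [hFψ, neg_zero] at h1
      have h2 : ∀ x : ℝ, w x * (-lam (i + 1) * φ (i + 1) x) =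
          -lam (i + 1) * (φ (i + 1) x * w x) := fun x => by ring
      simp_rw [h2] at h1
      rw [integral_const_mul] at h1
      rw [← (mul_eq_zero.1 h1).resolve_left (neg_ne_zero.2 (hpos i).ne')]
      refine integral_congr_ae (P.ae_mV_mem.mono fun x hx => ?_)
      simp only [lift_coe hw01 ⟨hx.1.le, hx.2⟩]
    have hwc0 : hwm.toLp = (inner ℝ (ν 0) hwm.toLp : ℝ) • ν 0 := by
      refine (HilbertBasis.mk h.orthonormal h.complete.ge).repr.injective (lp.ext (funext fun i => ?_))
      rw [HilbertBasis.repr_apply_apply, HilbertBasis.repr_apply_apply, HilbertBasis.coe_mk,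
        inner_smul_right, orthonormal_pair h.orthonormal]
      rcases i with _ | i
      · simp
      · simp [hwν]
    have hwae : ∀ᵐ x ∂P.mV, w x = inner ℝ (ν 0) hwm.toLp * φ 0 (0 : ℝ) := by
      have h1 : lift w =ᵐ[P.meas 0] fun _ => inner ℝ (ν 0) hwm.toLp * φ 0 (0 : ℝ) := by
        have h2 := hwm.coeFn_toLp
        rw [hwc0] at h2
        filter_upwards [h2, Lp.coeFn_smul (inner ℝ (ν 0) hwm.toLp) (ν 0), hν 0] with x h3 h4 h5
        rw [← h3, h4, Pi.smul_apply, h5, smul_eq_mul, hconst 0 h.lam_zero]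
      filter_upwards [P.ae_meas_iff.1 h1, P.ae_mV_mem] with x hx hx1
      rw [← hx, lift_coe hw01 ⟨hx1.1.le, hx1.2⟩]
    rw [Lp.eq_zero_iff_ae_eq_zero]
    exact P.ae_meas_iff.2 (P.ae_eq_zero_of_primW_eq_const hFi hF0 hwae)
  set B₀ : HilbertBasis ℕ ℝ (P.L2 0) := HilbertBasis.mk h.orthonormal h.complete.ge with hB₀
  set B₁ : HilbertBasis ℕ ℝ (P.L2 1) := HilbertBasis.mkOfOrthogonalEqBot horth hcompl with hB₁
  have hB₀ν : ∀ i, B₀ i = ν i := fun i => congrFun (HilbertBasis.coe_mk _ _) i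
  have hB₁E : ∀ i, B₁ i = E₁ i := fun i =>
    congrFun (HilbertBasis.coe_mkOfOrthogonalEqBot _ _) i
  have hd₀ : ∀ i, IsLeftDeriv P.W (φ i) fun x => (-1) ^ 0 * √(lam i) * e₁ i x := by
    intro i
    rcases i with _ | i
    · have h1 : φ 0 = fun _ => φ 0 (0 : ℝ) := funext (hconst 0 h.lam_zero)
      rw [h1, h.lam_zero]
      simp only [Real.sqrt_zero, mul_zero, zero_mul]
      exact isDeriv_const P 0 (φ 0 (0 : ℝ))
    · have h1 : (fun x => (-1) ^ 0 * √(lam (i + 1)) * e₁ (i + 1) x) = ψ (i + 1) := by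
        funext x
        rw [he₁s, pow_zero, one_mul, mul_inv_cancel_left₀ (Real.sqrt_ne_zero'.2 (hpos i))]
      rw [h1]
      exact hφψ (i + 1)
  have hd₁ : ∀ i, IsRightDeriv P.V (e₁ i) fun x => (-1) ^ 1 * √(lam i) * φ i x := by
    intro i
    rcases i with _ | i
    · rw [he₁0, h.lam_zero]
      simp only [Real.sqrt_zero, mul_zero, zero_mul]
      exact isDeriv_const P 1 (√(P.W 1))⁻¹
    · have h1 : (fun x => (-1) ^ 1 * √(lam (i + 1)) * φ (i + 1) x) =
          fun x => (√(lam (i + 1)))⁻¹ * (-lam (i + 1) * φ (i + 1) x) := by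
        funext x
        have h2 : (√(lam (i + 1)))⁻¹ * lam (i + 1) = √(lam (i + 1)) := by
          rw [inv_mul_eq_div, Real.div_sqrt]
        rw [← mul_assoc, mul_neg, h2, pow_one, neg_one_mul]
      rw [h1, he₁s]
      exact IsDeriv.const_mul P (n := 1) (hψφ (i + 1)) _
  refine ⟨alternate φ e₁, alternateBasis P B₀ B₁, ⟨h.lam_zero, hpos, h.lam_mono, fun _ => rfl, ?_, ?_, ?_, ?_⟩, hB₀ν⟩
  · intro n
    induction n using Nat.twoStepInduction with
    | zero => exact hφ
    | one => exact hlim₁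
    | more n ih _ => exact ih
  · intro n
    induction n using Nat.twoStepInduction with
    | zero => exact ⟨_, hconst 0 h.lam_zero⟩
    | one => exact ⟨_, fun x => congrFun he₁0 x⟩
    | more n ih _ => exact ih
  · intro n
    induction n using Nat.twoStepInduction with
    | zero => exact hd₀
    | one => exact hd₁
    | more n ih _ =>
      simp only [pow_succ, mul_neg, mul_one, neg_neg]
      exact ih
  · intro n
    induction n using Nat.twoStepInduction with
    | zero => exact fun i => (hB₀ν i).symm ▸ hν i
    | one => exact fun i => (hB₁E i).symm ▸ hE₁ae i
    | more n ih _ => exact ih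

/-! ### Coefficients with respect to a Hilbert basis -/

section HilbertBasis

variable {H : Type*} [NormedAddCommGroup H] [InnerProductSpace ℝ H]

theorem summable_inner_sq (B : HilbertBasis ℕ ℝ H) (x : H) :
    Summable fun i => inner ℝ (B i) x ^ 2 := by
  refine (B.summable_inner_mul_inner x x).congr fun i => ?_
  rw [real_inner_comm, sq]

theorem norm_sq_eq_tsum (B : HilbertBasis ℕ ℝ H) (x : H) :
    ‖x‖ ^ 2 = ∑' i, inner ℝ (B i) x ^ 2 := by
  rw [← real_inner_self_eq_norm_sq, ← B.tsum_inner_mul_inner x x]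
  refine tsum_congr fun i => ?_
  rw [real_inner_comm, sq]

theorem exists_of_summable_sq (B : HilbertBasis ℕ ℝ H) {a : ℕ → ℝ}
    (ha : Summable fun i => a i ^ 2) : ∃ x, ∀ i, inner ℝ (B i) x = a i := by
  have h : Memℓp a 2 := by
    refine memℓp_gen ?_
    simpa using ha
  refine ⟨B.repr.symm ⟨a, h⟩, fun i => ?_⟩
  rw [← B.repr_apply_apply, LinearIsometryEquiv.apply_symm_apply]

theorem hasSum_inner_smul (B : HilbertBasis ℕ ℝ H) (x : H) :
    HasSum (fun i => inner ℝ (B i) x • B i) x := by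
  simpa only [B.repr_apply_apply] using B.hasSum_repr x

theorem inner_eq_of_hasSum (B : HilbertBasis ℕ ℝ H) {x : H} {a : ℕ → ℝ}
    (h : HasSum (fun i => a i • B i) x) (i : ℕ) : inner ℝ (B i) x = a i := by
  have h1 := h.mapL (innerSL ℝ (B i))
  simp only [innerSL_apply_apply, inner_smul_right, orthonormal_pair B.orthonormal] at h1
  refine h1.unique ?_
  have := hasSum_single (f := fun j => a j * if i = j then (1 : ℝ) else 0) i
    (fun j hj => by simp [hj.symm])
  simpa using this

end HilbertBasis

/-! ### Smooth functions -/

/-- `IsIterDeriv` splits off the last derivative; showing that the derivative of a smooth function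
is smooth requires splitting off the first. -/
theorem isIterDeriv_succ (P : WVPair) {m : ℕ} : ∀ {k : ℕ} {f g : UnitAddCircle → ℝ},
    P.IsIterDeriv m (k + 1) f g ↔ ∃ h, P.IsDeriv m f h ∧ P.IsIterDeriv (m + 1) k h g
  | 0, f, g =>
    ⟨fun ⟨h, h1, h2⟩ => ⟨g, (show h = f from h1) ▸ h2, rfl⟩,
      fun ⟨h, h1, h2⟩ => ⟨f, rfl, (show g = h from h2) ▸ h1⟩⟩
  | k + 1, f, g => by
    have e : m + 1 + k = m + (k + 1) := by omega
    constructor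
    · rintro ⟨h, h12, h3⟩
      obtain ⟨h', h1, h2⟩ := (P.isIterDeriv_succ (k := k)).1 h12
      exact ⟨h', h1, h, h2, e ▸ h3⟩
    · rintro ⟨h', h1, h, h2, h3⟩
      exact ⟨h, (P.isIterDeriv_succ (k := k)).2 ⟨h', h1, h2⟩, e ▸ h3⟩

theorem IsIterDeriv.add_mul (P : WVPair) {m : ℕ} : ∀ {n : ℕ} {f g f' g' : UnitAddCircle → ℝ},
    P.IsIterDeriv m n f f' → P.IsIterDeriv m n g g' → ∀ c : ℝ,
      P.IsIterDeriv m n (fun x => f x + c * g x) (fun x => f' x + c * g' x)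
  | 0, _, _, _, _, hf, hg, c => by
    simp only [IsIterDeriv] at hf hg ⊢
    rw [hf, hg]
  | n + 1, _, _, _, _, ⟨h, h1, h2⟩, ⟨k, k1, k2⟩, c =>
    ⟨_, IsIterDeriv.add_mul P h1 k1 c, IsDeriv.add_mul P h2 k2 c⟩

theorem MemC.add_mul (P : WVPair) {n : ℕ} {f g : UnitAddCircle → ℝ} (hf : P.MemC n f)
    (hg : P.MemC n g) (c : ℝ) : P.MemC n fun x => f x + c * g x := by
  rw [memC_iff] at *
  refine ⟨hf.1.add_mul hg.1 c, ?_⟩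
  rw [integral_add (hf.1.integrable P n) ((hg.1.integrable P n).const_mul c), integral_const_mul,
    hf.2, hg.2, mul_zero, add_zero]

theorem memC_zero (P : WVPair) (n : ℕ) : P.MemC n fun _ => 0 := by
  rw [memC_iff]
  exact ⟨isLim_const n 0, by simp⟩

theorem isIterDeriv_zero (P : WVPair) (m : ℕ) : ∀ n, P.IsIterDeriv m n (fun _ => 0) fun _ => 0
  | 0 => rfl
  | n + 1 => ⟨_, isIterDeriv_zero P m n, isDeriv_const P _ 0⟩

theorem CInf_add_mul (P : WVPair) {m : ℕ} {f g : UnitAddCircle → ℝ} (hf : f ∈ P.CInf m)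
    (hg : g ∈ P.CInf m) (c : ℝ) : (fun x => f x + c * g x) ∈ P.CInf m := by
  obtain ⟨a, f, hf, rfl⟩ := hf
  obtain ⟨b, g, hg, rfl⟩ := hg
  refine ⟨a + c * b, fun x => f x + c * g x, ?_, by funext x; ring⟩
  simp only [mem_iInter] at hf hg ⊢
  intro n hn
  obtain ⟨h1, f', h2, h3⟩ := hf n hn
  obtain ⟨k1, g', k2, k3⟩ := hg n hn
  exact ⟨MemC.add_mul P h1 k1 c, _, IsIterDeriv.add_mul P h2 k2 c, MemC.add_mul P h3 k3 c⟩

theorem const_mem_CInf (P : WVPair) (m : ℕ) (c : ℝ) : (fun _ => c) ∈ P.CInf m := by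
  refine ⟨c, fun _ => 0, ?_, by simp⟩
  simp only [mem_iInter]
  exact fun n _ => ⟨P.memC_zero m, _, P.isIterDeriv_zero m n, P.memC_zero _⟩

theorem isLim_of_mem_CInf (P : WVPair) {m : ℕ} {g : UnitAddCircle → ℝ} (hg : g ∈ P.CInf m) :
    IsLim m g := by
  obtain ⟨c, g, hg, rfl⟩ := hg
  simp only [mem_iInter] at hg
  have := (isLim_const m c).add_mul (P.memC_iff.1 (hg 1 self_mem_Ici).1).1 1
  simpa using this

theorem exists_deriv_of_mem_CInf (P : WVPair) {m : ℕ} {g : UnitAddCircle → ℝ}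
    (hg : g ∈ P.CInf m) : ∃ g' ∈ P.CInf (m + 1), P.IsDeriv m g g' := by
  obtain ⟨c, g, hg, rfl⟩ := hg
  simp only [mem_iInter] at hg
  obtain ⟨h1, g', h2, h3⟩ := hg 1 self_mem_Ici
  obtain ⟨_, rfl, h2⟩ := h2
  refine ⟨g', ⟨0, g', ?_, by simp⟩, ?_⟩
  · simp only [mem_iInter]
    intro n hn
    obtain ⟨-, f', h4, h5⟩ := hg (n + 1) (mem_Ici.2 (by omega))
    obtain ⟨h, h6, h7⟩ := P.isIterDeriv_succ.1 h4
    -- Every longer chain starts with the same first derivative, by uniqueness of limits.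
    obtain rfl : h = g' := IsDeriv.unique P h6 h2
    rw [show m + (n + 1) = m + 1 + n by omega] at h5
    exact ⟨h3, f', h7, h5⟩
  · simpa using IsDeriv.add_mul P (isDeriv_const P m c) h2 1

theorem mem_CInf_of_isDeriv (P : WVPair) {m : ℕ} {g g' : UnitAddCircle → ℝ}
    (hg : g ∈ P.CInf m) (h : P.IsDeriv m g g') : g' ∈ P.CInf (m + 1) := by
  obtain ⟨k, hk, hgk⟩ := P.exists_deriv_of_mem_CInf hg
  rwa [IsDeriv.unique P h hgk]

/-- Strong derivatives of smooth functions are weak derivatives. -/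
theorem isWeakDeriv_of_isDeriv (P : WVPair) {n : ℕ} {f f' : UnitAddCircle → ℝ}
    (hf : f ∈ P.CInf n) (h : P.IsDeriv n f f') {F : P.L2 n} {F' : P.L2 (n + 1)}
    (hF : F =ᵐ[P.meas n] f) (hF' : F' =ᵐ[P.meas (n + 1)] f') : P.IsWeakDeriv n F F' := by
  intro g hg g' hgg'
  have hf' := P.isLim_of_mem_CInf (P.mem_CInf_of_isDeriv hf h)
  have hg' : IsLim n g' := P.isLim_of_mem_CInf (m := n + 2) (P.mem_CInf_of_isDeriv hg hgg')
  rw [integral_congr_ae (g := fun x => f x * g' x) (hF.mono fun x hx => by simp only [hx]),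
    integral_congr_ae (f := fun x => F' x * g x) (g := fun x => f' x * g x)
      (hF'.mono fun x hx => by simp only [hx])]
  exact P.integral_mul_deriv (P.isLim_of_mem_CInf hf) hf' (P.isLim_of_mem_CInf hg) hg' h hgg'

theorem smoothClasses_subset_Hk (P : WVPair) (k : ℕ) : P.smoothClasses ⊆ P.Hk k := by
  rintro h ⟨g, hg, hhg⟩ n -
  -- The induction carries a smooth representative along, so that a next strong derivative is
  -- available.
  have key : ∀ n, ∃ F : P.L2 n, P.IsIterWeakDeriv n h F ∧ ∃ f ∈ P.CInf n, F =ᵐ[P.meas n] f := by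
    intro n
    induction n with
    | zero => exact ⟨h, rfl, g, hg, hhg⟩
    | succ n ih =>
      obtain ⟨F, hF, f, hf, hFf⟩ := ih
      obtain ⟨f', hf', hff'⟩ := P.exists_deriv_of_mem_CInf hf
      have hm : MemLp f' 2 (P.meas (n + 1)) := (P.isLim_of_mem_CInf hf').memLp P (n + 1)
      exact ⟨hm.toLp, ⟨F, hF, P.isWeakDeriv_of_isDeriv hf hff' hFf hm.coeFn_toLp⟩, f', hf',
        hm.coeFn_toLp⟩
  exact (key n).imp fun F hF => hF.1

/-! ### Weak derivatives in coefficients -/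

namespace IsSystem

variable {P : WVPair} {lam : ℕ → ℝ} {e : ℕ → ℕ → UnitAddCircle → ℝ}
  {E : (n : ℕ) → HilbertBasis ℕ ℝ (P.L2 n)}

theorem const_ne_zero (S : P.IsSystem lam e E) {n : ℕ} {c : ℝ} (hc : ∀ x, e n 0 x = c) :
    c ≠ 0 := by
  rintro rfl
  have h := orthonormal_pair (E n).orthonormal 0 0
  rw [P.inner_L2_of_ae (S.ae n 0) (S.ae n 0)] at h
  simp [hc] at h

/-- Mean zero is orthogonality to the constant member of the basis. -/
theorem memC (S : P.IsSystem lam e E) (n i : ℕ) : P.MemC n (e n (i + 1)) := by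
  refine P.memC_iff.2 ⟨S.isLim n _, ?_⟩
  obtain ⟨c, hc⟩ := S.const n
  have h := orthonormal_pair (E n).orthonormal 0 (i + 1)
  rw [P.inner_L2_of_ae (S.ae n 0) (S.ae n (i + 1))] at h
  simp_rw [hc] at h
  rw [integral_const_mul] at h
  simpa [S.const_ne_zero hc] using h

theorem exists_isIterDeriv (S : P.IsSystem lam e E) (m i : ℕ) : ∀ n, ∃ c : ℝ,
    P.IsIterDeriv m n (e m i) fun x => c * e (m + n) i x
  | 0 => ⟨1, by simp [IsIterDeriv]⟩
  | n + 1 => by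
    obtain ⟨c, hc⟩ := S.exists_isIterDeriv m i n
    refine ⟨c * ((-1) ^ (m + n) * √(lam i)), _, hc, ?_⟩
    have := IsDeriv.const_mul P (S.deriv (m + n) i) c
    simp only [← mul_assoc] at this ⊢
    exact this

theorem mem_CInf (S : P.IsSystem lam e E) (n i : ℕ) : e n i ∈ P.CInf n := by
  rcases i with _ | i
  · obtain ⟨c, hc⟩ := S.const n
    rw [funext hc]
    exact P.const_mem_CInf n c
  · refine ⟨0, e n (i + 1), ?_, by simp⟩
    simp only [mem_iInter]
    intro k _
    obtain ⟨c, hc⟩ := S.exists_isIterDeriv n (i + 1) k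
    refine ⟨S.memC n i, _, hc, ?_⟩
    simpa using MemC.add_mul P (P.memC_zero _) (S.memC (n + k) i) c

/-- Weak differentiation is diagonal. Each `e (n + 1) i` is an admissible test function, and testing
with it yields the coefficients of `F`. Conversely, for any smooth `g` the coefficients of `g'` come
from integrating by parts against `e n i`, and Parseval at both levels gives the defining identity.
-/
theorem isWeakDeriv_iff (S : P.IsSystem lam e E) {n : ℕ} {f : P.L2 n} {F : P.L2 (n + 1)} :
    P.IsWeakDeriv n f F ↔
      ∀ i, inner ℝ (E (n + 1) i) F = (-1) ^ n * √(lam i) * inner ℝ (E n i) f := by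
  constructor
  · intro h i
    have h1 := h _ (S.mem_CInf (n + 1) i) _ (S.deriv (n + 1) i)
    rw [real_inner_comm, real_inner_comm f, P.inner_L2_of_ae (EventuallyEq.refl _ _) (S.ae _ _),
      P.inner_L2_of_ae (EventuallyEq.refl _ _) (S.ae _ _)]
    have h2 : ∀ x, f x * ((-1) ^ (n + 1) * √(lam i) * e (n + 1 + 1) i x) =
        (-1) ^ (n + 1) * √(lam i) * (f x * e n i x) := fun x => by
      rw [show e (n + 1 + 1) = e n from S.periodic n]; ring
    simp_rw [h2] at h1
    rw [integral_const_mul, pow_succ] at h1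
    linarith
  · intro h g hg g' hgg'
    have hgl : IsLim (n + 1) g := P.isLim_of_mem_CInf hg
    have hgl' : IsLim n g' := P.isLim_of_mem_CInf (m := n + 2) (P.mem_CInf_of_isDeriv hg hgg')
    have hm := hgl.memLp P (n + 1)
    have hm' := hgl'.memLp P n
    have hcoef : ∀ i, inner ℝ (E n i) hm'.toLp =
        -((-1) ^ n * √(lam i) * inner ℝ (E (n + 1) i) hm.toLp) := by
      intro i
      rw [P.inner_L2_of_ae (S.ae n i) hm'.coeFn_toLp,
        P.inner_L2_of_ae (S.ae (n + 1) i) hm.coeFn_toLp]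
      have h1 := P.integral_mul_deriv (S.isLim n i) ((S.isLim (n + 1) i).const_mul _) hgl hgl'
        (S.deriv n i) hgg'
      simp_rw [mul_assoc _ (e (n + 1) i _)] at h1
      rw [h1, integral_const_mul]
    rw [← P.inner_L2_of_ae (EventuallyEq.refl _ f) hm'.coeFn_toLp,
      ← P.inner_L2_of_ae (EventuallyEq.refl _ F) hm.coeFn_toLp,
      ← (E n).tsum_inner_mul_inner, ← (E (n + 1)).tsum_inner_mul_inner, ← tsum_neg]
    refine tsum_congr fun i => ?_
    rw [hcoef, real_inner_comm, real_inner_comm (E (n + 1) i) F, h]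
    ring

/-- Squaring removes the signs, and squared coefficients are all that membership and norms depend
on. -/
theorem inner_sq_of_isIterWeakDeriv (S : P.IsSystem lam e E) {f : P.L2 0} : ∀ {n : ℕ} {F : P.L2 n},
    P.IsIterWeakDeriv n f F → ∀ i, inner ℝ (E n i) F ^ 2 = lam i ^ n * inner ℝ (E 0 i) f ^ 2
  | 0, _, h, i => by
    simp only [IsIterWeakDeriv] at h
    rw [h]; simp
  | n + 1, F, ⟨G, h1, h2⟩, i => by
    have hl : 0 ≤ lam i := S.lam_zero.symm.le.trans (S.lam_mono (Nat.zero_le i))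
    rw [S.isWeakDeriv_iff.1 h2, mul_pow, mul_pow, S.inner_sq_of_isIterWeakDeriv h1, ← pow_mul,
      mul_comm n 2, pow_mul, Real.sq_sqrt hl]
    ring

/-- The spectral gap `0 < lam 1 ≤ lam (i + 1)` allows comparison of the two series once the term at
index 0 is dropped. -/
theorem summable_of_succ (S : P.IsSystem lam e E) {a : ℕ → ℝ} {n : ℕ}
    (h : Summable fun i => lam i ^ (n + 1) * a i ^ 2) : Summable fun i => lam i ^ n * a i ^ 2 := by
  rw [← summable_nat_add_iff 1] at h ⊢
  have h0 : 0 < lam 1 := S.lam_pos 0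
  have hnn : ∀ i, 0 ≤ lam (i + 1) ^ n * a (i + 1) ^ 2 := fun i =>
    mul_nonneg (pow_nonneg (S.lam_pos i).le n) (sq_nonneg (a (i + 1)))
  refine Summable.of_nonneg_of_le hnn (fun i => ?_) (h.mul_left (lam 1)⁻¹)
  have h1 : lam 1 ≤ lam (i + 1) := S.lam_mono (Nat.succ_le_succ (Nat.zero_le i))
  rw [pow_succ' (lam (i + 1)), mul_assoc (lam (i + 1)), ← mul_assoc (lam 1)⁻¹]
  refine le_mul_of_one_le_left (hnn i) ?_
  rw [inv_mul_eq_div, one_le_div h0]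
  exact h1

theorem exists_isIterWeakDeriv_iff (S : P.IsSystem lam e E) {f : P.L2 0} {n : ℕ} :
    (∃ F : P.L2 n, P.IsIterWeakDeriv n f F) ↔
      Summable fun i => lam i ^ n * inner ℝ (E 0 i) f ^ 2 := by
  constructor
  · rintro ⟨F, hF⟩
    exact (summable_inner_sq (E n) F).congr fun i => S.inner_sq_of_isIterWeakDeriv hF i
  · induction n with
    | zero => exact fun _ => ⟨f, rfl⟩
    | succ n ih =>
      intro h
      obtain ⟨G, hG⟩ := ih (S.summable_of_succ h)
      obtain ⟨F, hF⟩ := exists_of_summable_sq (E (n + 1))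
        (a := fun i => (-1) ^ n * √(lam i) * inner ℝ (E n i) G) (h.congr fun i => by
          have hl : 0 ≤ lam i := S.lam_zero.symm.le.trans (S.lam_mono (Nat.zero_le i))
          rw [mul_pow, mul_pow, S.inner_sq_of_isIterWeakDeriv hG, ← pow_mul,
            mul_comm n 2, pow_mul, Real.sq_sqrt hl]
          ring)
      exact ⟨F, G, hG, S.isWeakDeriv_iff.2 hF⟩

theorem summable_of_le (S : P.IsSystem lam e E) {a : ℕ → ℝ} {k n : ℕ} (hn : n ≤ k)
    (h : Summable fun i => lam i ^ k * a i ^ 2) : Summable fun i => lam i ^ n * a i ^ 2 := by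
  induction k, hn using Nat.le_induction with
  | base => exact h
  | succ k _ ih => exact ih (S.summable_of_succ h)

theorem mem_Hk_iff (S : P.IsSystem lam e E) {f : P.L2 0} {k : ℕ} :
    f ∈ P.Hk k ↔ Summable fun i => lam i ^ k * inner ℝ (E 0 i) f ^ 2 := by
  constructor
  · intro h
    -- `Hk 0` imposes no condition, and neither does the series, since `lam i ^ 0 = 1` also at `lam
    -- 0 = 0`.
    rcases Nat.eq_zero_or_pos k with rfl | hk
    · simpa using summable_inner_sq (E 0) f
    · exact S.exists_isIterWeakDeriv_iff.1 (h k (Finset.mem_Icc.2 ⟨hk, le_rfl⟩))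
  · intro h n hn
    exact S.exists_isIterWeakDeriv_iff.2 (S.summable_of_le (Finset.mem_Icc.1 hn).2 h)

/-- `weakDeriv` is a choice, but any choice has the same squared coefficients. -/
theorem norm_weakDeriv_sq (S : P.IsSystem lam e E) {f : P.L2 0} {n : ℕ}
    (h : Summable fun i => lam i ^ n * inner ℝ (E 0 i) f ^ 2) :
    ‖P.weakDeriv n f‖ ^ 2 = ∑' i, lam i ^ n * inner ℝ (E 0 i) f ^ 2 := by
  have hex := S.exists_isIterWeakDeriv_iff.2 h
  rw [weakDeriv, dif_pos hex, norm_sq_eq_tsum (E n)]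
  exact tsum_congr fun i => S.inner_sq_of_isIterWeakDeriv hex.choose_spec i

/-! ### The spectral description of the Sobolev spaces -/

theorem Hk_eq (S : P.IsSystem lam e E) (k : ℕ) :
    P.Hk k = {f : P.L2 0 | ∃ α : ℕ → ℝ,
      HasSum (fun i : ℕ => α (i + 1) • E 0 (i + 1)) (f - Lp.const 2 (P.meas 0) (α 0)) ∧
      Summable (fun i : ℕ => lam (i + 1) ^ k * α (i + 1) ^ 2)} := by
  obtain ⟨c, hc⟩ := S.const 0
  have hc0 := S.const_ne_zero hc
  have hconst : ∀ a : ℝ, Lp.const 2 (P.meas 0) (a * c) = a • E 0 0 := by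
    intro a
    refine Lp.ext ?_
    filter_upwards [Lp.coeFn_const 2 (P.meas 0) (a * c), Lp.coeFn_smul a (E 0 0), S.ae 0 0]
      with x h1 h2 h3
    rw [h1, h2, Pi.smul_apply, h3, hc]
    rfl
  ext f
  rw [S.mem_Hk_iff, mem_ofPred_eq, ← summable_nat_add_iff 1]
  constructor
  · intro h
    -- `α 0` is the value of the constant term, while `E 0 0` is the constant `c`; hence the factor
    -- `c` here and the division by `c` in the converse.
    refine ⟨fun i => if i = 0 then inner ℝ (E 0 0) f * c else inner ℝ (E 0 i) f, ?_, ?_⟩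
    · have h1 := (hasSum_nat_add_iff' 1).2 (hasSum_inner_smul (E 0) f)
      simp only [Finset.sum_range_one] at h1
      simpa [hconst] using h1
    · simpa using h
  · rintro ⟨α, h1, h2⟩
    have h3 : HasSum (fun i => (if i = 0 then α 0 / c else α i) • E 0 i) f := by
      rw [← hasSum_nat_add_iff' 1]
      simp only [Finset.sum_range_one]
      have h4 := hconst (α 0 / c)
      rw [div_mul_cancel₀ _ hc0] at h4
      simpa [← h4] using h1
    refine h2.congr fun i => ?_
    rw [inner_eq_of_hasSum _ h3, if_neg (Nat.succ_ne_zero i)]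

theorem sum_mem_smoothClasses (S : P.IsSystem lam e E) (a : ℕ → ℝ) (N : ℕ) :
    ∑ i ∈ Finset.range N, a i • E 0 i ∈ P.smoothClasses := by
  induction N with
  | zero =>
    refine ⟨_, P.const_mem_CInf 0 0, ?_⟩
    rw [Finset.sum_range_zero]
    exact Lp.coeFn_zero ℝ 2 (P.meas 0)
  | succ N ih =>
    obtain ⟨g, hg, hgN⟩ := ih
    refine ⟨_, P.CInf_add_mul hg (S.mem_CInf 0 N) (a N), ?_⟩
    rw [Finset.sum_range_succ]
    filter_upwards [Lp.coeFn_add (∑ i ∈ Finset.range N, a i • E 0 i) (a N • E 0 N), hgN,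
      Lp.coeFn_smul (a N) (E 0 N), S.ae 0 N] with x h1 h2 h3 h4
    rw [h1, Pi.add_apply, h2, h3, Pi.smul_apply, h4, smul_eq_mul]

/-- The partial sums of the eigenfunction expansion are smooth, and the squared Sobolev norm of the
remainder is a finite sum of tails of convergent series. -/
theorem exists_smooth_near (S : P.IsSystem lam e E) {k : ℕ} {f : P.L2 0} (hf : f ∈ P.Hk k)
    {ε : ℝ} (hε : 0 < ε) : ∃ h ∈ P.smoothClasses, P.sobNorm k (f - h) < ε := by
  rw [S.mem_Hk_iff] at hf
  set a : ℕ → ℝ := fun i => inner ℝ (E 0 i) f with ha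
  set T : ℕ → P.L2 0 := fun N => ∑ i ∈ Finset.range N, a i • E 0 i with hT
  have hcoef : ∀ N i, inner ℝ (E 0 i) (f - T N) = if i < N then 0 else a i := by
    intro N i
    rw [inner_sub_right, hT, inner_sum]
    simp only [inner_smul_right, orthonormal_pair (E 0).orthonormal]
    simp only [mul_ite, mul_one, mul_zero, Finset.sum_ite_eq, Finset.mem_range]
    split_ifs <;> simp [ha]
  have htail : ∀ n ≤ k, ∀ N, HasSum (fun i => lam i ^ n * inner ℝ (E 0 i) (f - T N) ^ 2)
      (∑' i, lam (i + N) ^ n * a (i + N) ^ 2) := by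
    intro n hn N
    have h1 := (summable_nat_add_iff N).2 (S.summable_of_le hn hf)
    have h2 := (hasSum_nat_add_iff (f := fun i => lam i ^ n * inner ℝ (E 0 i) (f - T N) ^ 2)
      (g := ∑' i, lam (i + N) ^ n * a (i + N) ^ 2) N).1 (by
        refine h1.hasSum.congr_fun fun i => ?_
        rw [hcoef, if_neg (by omega)])
    rw [Finset.sum_eq_zero, add_zero] at h2
    · exact h2
    · intro i hi
      rw [hcoef, if_pos (Finset.mem_range.1 hi)]; simp
  have hlim : ∀ n ≤ k, Tendsto (fun N => ‖P.weakDeriv n (f - T N)‖ ^ 2) atTop (𝓝 0) := by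
    intro n hn
    refine (tendsto_sum_nat_add fun i => lam i ^ n * a i ^ 2).congr fun N => ?_
    rw [S.norm_weakDeriv_sq (htail n hn N).summable, (htail n hn N).tsum_eq]
  have hlim0 : Tendsto (fun N => ‖f - T N‖ ^ 2) atTop (𝓝 0) := by
    refine (tendsto_sum_nat_add fun i => lam i ^ 0 * a i ^ 2).congr fun N => ?_
    rw [norm_sq_eq_tsum (E 0), ← (htail 0 (Nat.zero_le k) N).tsum_eq]
    simp
  have hsob : Tendsto (fun N => P.sobNorm k (f - T N)) atTop (𝓝 0) := by
    have h1 := (hlim0.add (tendsto_finsetSum (Finset.Icc 1 k)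
      fun n hn => hlim n (Finset.mem_Icc.1 hn).2)).sqrt
    simp only [Finset.sum_const_zero, add_zero, Real.sqrt_zero] at h1
    exact h1
  obtain ⟨N, hN⟩ := (hsob.eventually_lt_const hε).exists
  exact ⟨T N, S.sum_mem_smoothClasses a N, hN⟩

end IsSystem

/-! ### Enumeration of the eigenvectors of a compact operator -/

/-- Breaking ties by an injection into `ℕ` gives a linear order with finite initial segments.
Counting predecessors embeds it in `ℕ`, and an infinite subset of `ℕ` is order isomorphic to `ℕ`.
Finite sublevel sets make the monotone sequence unbounded. -/
theorem exists_monotone_enumeration {ι : Type*} [Infinite ι] (g : ι → ℝ)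
    (hfin : ∀ R : ℝ, {i | g i ≤ R}.Finite) :
    ∃ σ : ℕ ≃ ι, Monotone (g ∘ σ) ∧ Tendsto (g ∘ σ) atTop atTop := by
  have hcount : Countable ι := by
    rw [← countable_univ_iff]
    refine (countable_iUnion fun n : ℕ => (hfin n).countable).mono fun i _ => ?_
    obtain ⟨n, hn⟩ := exists_nat_ge (g i)
    exact mem_iUnion.2 ⟨n, hn⟩
  obtain ⟨k, hk⟩ := exists_injective_nat ι
  let _ : LinearOrder ι := LinearOrder.lift' (fun i => toLex (g i, k i)) fun i j hij => by
    have := congrArg (fun z => (ofLex z).2) hij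
    exact hk this
  have hg : Monotone g := fun i j hij => by
    have : toLex (g i, k i) ≤ toLex (g j, k j) := hij
    exact Prod.Lex.monotone_fst _ _ this
  have hIio : ∀ i : ι, (Iio i).Finite := fun i =>
    (hfin (g i)).subset fun j hj => hg (le_of_lt hj)
  set r : ι → ℕ := fun i => (Iio i).ncard with hr
  have hr_mono : StrictMono r := fun i j hij =>
    ncard_lt_ncard (Iio_ssubset_Iio hij) (hIio j)
  have : Infinite (range r) := (infinite_range_of_injective hr_mono.injective).to_subtype
  classical
  set τ := Nat.Subtype.orderIsoOfNat (range r) with hτ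
  set ρ := Equiv.ofInjective r hr_mono.injective with hρ
  have hσ : ∀ n, r (ρ.symm (τ n)) = τ n := fun n => by
    have := congrArg Subtype.val (ρ.apply_symm_apply (τ n))
    exact this
  have hmono : Monotone (g ∘ (τ.toEquiv.trans ρ.symm)) := by
    intro n m hnm
    refine hg (hr_mono.le_iff_le.1 ?_)
    change r (ρ.symm (τ n)) ≤ r (ρ.symm (τ m))
    rw [hσ, hσ]
    exact τ.monotone hnm
  refine ⟨τ.toEquiv.trans ρ.symm, hmono, tendsto_atTop_atTop_of_monotone hmono fun R => ?_⟩
  obtain ⟨i, hi⟩ := (hfin R).exists_notMem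
  refine ⟨(τ.toEquiv.trans ρ.symm).symm i, ?_⟩
  rw [Function.comp_apply, Equiv.apply_symm_apply]
  exact (not_le.1 hi).le

section Spectral

open Module End

variable {H : Type*} [NormedAddCommGroup H] [InnerProductSpace ℝ H] {T : H →L[ℝ] H}

theorem finite_of_le_eigenvalue (hc : IsCompactOperator T) {ι : Type*} {v : ι → H}
    (hv : Orthonormal ℝ v) {μ : ι → ℝ} (hμ : ∀ i, T (v i) = μ i • v i) {r : ℝ} (hr : 0 < r) :
    {i | r ≤ μ i}.Finite := by
  by_contra hinf
  have hinf' : {i | r ≤ μ i}.Infinite := hinf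
  set f := hinf'.natEmbedding with hf
  have hcomp := IsCompactOperator.isCompact_closure_image_closedBall (f := (T : H →ₗ[ℝ] H)) hc 1
  obtain ⟨a, -, φ, hφ, hlim⟩ := hcomp.tendsto_subseq (x := fun n => T (v (f n))) fun n =>
    subset_closure ⟨v (f n), by simp [hv.1], rfl⟩
  have h1 := (hlim.comp (tendsto_add_atTop_nat 1)).sub hlim
  rw [sub_self] at h1
  have h2 := h1.norm
  rw [norm_zero] at h2
  obtain ⟨n, hn⟩ := (h2.eventually_lt_const hr).exists
  simp only [Function.comp_apply] at hn
  have hne : (f (φ (n + 1)) : ι) ≠ f (φ n) := fun h =>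
    (hφ (Nat.lt_succ_self n)).ne' (f.injective (Subtype.ext h))
  rw [hμ, hμ] at hn
  have h3 : ‖μ (f (φ (n + 1))) • v (f (φ (n + 1))) - μ (f (φ n)) • v (f (φ n))‖ ^ 2 =
      μ (f (φ (n + 1))) ^ 2 + μ (f (φ n)) ^ 2 := by
    rw [norm_sub_sq_real, inner_smul_left, inner_smul_right, hv.2 hne, norm_smul, norm_smul,
      hv.1, hv.1]
    simp
  have h4 : r ≤ μ (f (φ (n + 1))) := (f (φ (n + 1))).2
  have h5 := pow_lt_pow_left₀ hn (norm_nonneg _) two_ne_zero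
  rw [h3] at h5
  nlinarith [sq_nonneg (μ (f (φ n)))]

/-- Orthonormal bases of the eigenspaces for nonzero eigenvalues, together with `v₀`, are complete
by the spectral theorem. Compactness makes the sublevel sets of the inverted eigenvalues finite, so
they can be sorted; the kernel vector takes index 0 and the value 0. -/
theorem exists_sorted_eigenbasis [CompleteSpace H] (hc : IsCompactOperator T)
    (hs : (T : H →ₗ[ℝ] H).IsSymmetric) (hpos : ∀ x, 0 ≤ inner ℝ (T x) x) {v₀ : H} (hv₀ : ‖v₀‖ = 1)
    (hker : ∀ x, T x = 0 ↔ ∃ c : ℝ, x = c • v₀) (hinf : ¬ FiniteDimensional ℝ H) :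
    ∃ (ν : ℕ → H) (lam : ℕ → ℝ), Orthonormal ℝ ν ∧
      (Submodule.span ℝ (range ν)).topologicalClosure = ⊤ ∧ ν 0 = v₀ ∧ lam 0 = 0 ∧
      Monotone lam ∧ Tendsto lam atTop atTop ∧
      ∀ i, 0 < lam (i + 1) ∧ T (ν (i + 1)) = (lam (i + 1))⁻¹ • ν (i + 1) := by
  have hfd : ∀ μ : {μ : ℝ // μ ≠ 0}, FiniteDimensional ℝ (eigenspace (T : H →ₗ[ℝ] H) μ) :=
    fun μ => ContinuousLinearMap.finite_dimensional_eigenspace hc μ μ.2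
  let b := fun μ : {μ : ℝ // μ ≠ 0} => stdOrthonormalBasis ℝ (eigenspace (T : H →ₗ[ℝ] H) μ)
  let ι := Σ μ : {μ : ℝ // μ ≠ 0}, Fin (finrank ℝ (eigenspace (T : H →ₗ[ℝ] H) μ))
  let v : ι → H := fun i => (b i.1 i.2 : H)
  have hTv : ∀ i : ι, T (v i) = (i.1 : ℝ) • v i := fun i =>
    mem_eigenspace_iff.1 (b i.1 i.2).2
  have hv : Orthonormal ℝ v :=
    (hs.orthogonalFamily_eigenspaces.comp (γ := {μ : ℝ // μ ≠ 0})
      Subtype.coe_injective).orthonormal_sigma_orthonormal fun μ => (b μ).orthonormal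
  have hμpos : ∀ i : ι, 0 < (i.1 : ℝ) := by
    intro i
    refine lt_of_le_of_ne ?_ (Ne.symm i.1.2)
    have := hpos (v i)
    rwa [hTv, inner_smul_left, real_inner_self_eq_norm_sq, hv.1, one_pow, mul_one] at this
  have hv₀v : ∀ i, inner ℝ v₀ (v i) = 0 := by
    intro i
    have h1 : T v₀ = 0 := (hker v₀).2 ⟨1, (one_smul _ _).symm⟩
    have h2 := hs v₀ (v i)
    simp only [ContinuousLinearMap.coe_coe] at h2
    rw [h1, inner_zero_left, hTv, inner_smul_right] at h2
    exact (mul_eq_zero.1 h2.symm).resolve_left i.1.2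
  have hzero : ∀ x, inner ℝ v₀ x = 0 → (∀ i, inner ℝ (v i) x = 0) → x = 0 := by
    intro x h0 hx
    have h1 : x ∈ (⨆ μ, eigenspace (T : H →ₗ[ℝ] H) μ)ᗮ := by
      rw [← Submodule.iInf_orthogonal, Submodule.mem_iInf]
      intro μ y hy
      by_cases hμ : μ = 0
      · subst hμ
        rw [mem_eigenspace_iff, zero_smul] at hy
        obtain ⟨c, rfl⟩ := (hker y).1 hy
        rw [inner_smul_left, h0, mul_zero]
      · have h2 := (b ⟨μ, hμ⟩).sum_repr ⟨y, hy⟩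
        have h3 := congrArg (fun z => ((z : eigenspace (T : H →ₗ[ℝ] H) μ) : H)) h2
        simp only [AddSubmonoidClass.coe_finsetSum, Submodule.coe_smul] at h3
        rw [← h3, sum_inner]
        refine Finset.sum_eq_zero fun j _ => ?_
        rw [inner_smul_left]
        exact mul_eq_zero_of_right _ (hx ⟨⟨μ, hμ⟩, j⟩)
    rw [ContinuousLinearMap.orthogonalComplement_iSup_eigenspaces_eq_bot hc hs] at h1
    exact h1
  -- Finitely many eigenvectors together with `v₀` would span the whole space.
  have hι : Infinite ι := by
    by_contra hfin
    rw [not_infinite_iff_finite] at hfin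
    refine hinf ?_
    set K := Submodule.span ℝ (insert v₀ (range v)) with hK
    have hKfin : FiniteDimensional ℝ K :=
      FiniteDimensional.span_of_finite ℝ ((finite_range v).insert v₀)
    have hKtop : K = ⊤ := by
      rw [← Submodule.orthogonal_eq_bot_iff, Submodule.eq_bot_iff]
      intro x hx
      exact hzero x (hx _ (Submodule.subset_span (mem_insert _ _)))
        fun i => hx _ (Submodule.subset_span (mem_insert_of_mem _ ⟨i, rfl⟩))
    rw [hKtop] at hKfin
    exact Module.Finite.equiv (Submodule.topEquiv (R := ℝ) (M := H))
  have hsub : ∀ R : ℝ, {i : ι | (i.1 : ℝ)⁻¹ ≤ R}.Finite := by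
    intro R
    rcases le_or_gt R 0 with hR | hR
    · refine finite_empty.subset fun i hi => ?_
      exact absurd (inv_pos.2 (hμpos i)) (not_lt.2 (le_trans hi hR))
    · refine (finite_of_le_eigenvalue hc hv hTv (inv_pos.2 hR)).subset fun i hi => ?_
      exact inv_le_of_inv_le₀ (hμpos i) hi
  obtain ⟨σ, hσm, hσt⟩ := exists_monotone_enumeration _ hsub
  let ν : ℕ → H := fun n => Nat.casesOn n v₀ fun i => v (σ i)
  let lam : ℕ → ℝ := fun n => Nat.casesOn n 0 fun i => ((σ i).1 : ℝ)⁻¹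
  have hν : Orthonormal ℝ ν := by
    rw [orthonormal_iff_ite]
    rintro (_ | i) (_ | j)
    · simp [ν, hv₀]
    · simp [ν, hv₀v]
    · simp [ν, real_inner_comm, hv₀v]
    · classical
      have := orthonormal_iff_ite.1 hv (σ i) (σ j)
      simpa [ν] using this
  refine ⟨ν, lam, hν, ?_, rfl, rfl, ?_, ?_, ?_⟩
  · rw [Submodule.topologicalClosure_eq_top_iff, Submodule.eq_bot_iff]
    intro x hx
    refine hzero x (hx _ (Submodule.subset_span ⟨0, rfl⟩)) fun i => ?_
    refine hx _ (Submodule.subset_span ⟨σ.symm i + 1, ?_⟩)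
    simp [ν]
  · refine monotone_nat_of_le_succ ?_
    rintro (_ | i)
    · exact (inv_pos.2 (hμpos (σ 0))).le
    · exact hσm (Nat.le_succ i)
  · exact (tendsto_add_atTop_iff_nat 1).1 hσt
  · intro i
    refine ⟨inv_pos.2 (hμpos (σ i)), ?_⟩
    simp only [lam, ν, inv_inv]
    exact hTv (σ i)

end Spectral

/-! ### Removing the component along a vector -/

section

variable {H : Type*} [NormedAddCommGroup H] [InnerProductSpace ℝ H]

/-- The orthogonal projection onto the complement of `v`. -/
def removeComponent (v : H) : H →L[ℝ] H :=
  ContinuousLinearMap.id ℝ H - (innerSL ℝ v).smulRight ((‖v‖ ^ 2)⁻¹ • v)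

theorem removeComponent_apply (v x : H) :
    removeComponent v x = x - ((‖v‖ ^ 2)⁻¹ * inner ℝ v x) • v := by
  simp [removeComponent, smul_smul, mul_comm]

theorem inner_removeComponent {v : H} (hv : v ≠ 0) (x : H) :
    inner ℝ v (removeComponent v x) = 0 := by
  rw [removeComponent_apply, inner_sub_right, inner_smul_right, real_inner_self_eq_norm_sq,
    mul_right_comm, inv_mul_cancel₀ (pow_ne_zero 2 (norm_ne_zero_iff.2 hv)), one_mul, sub_self]

theorem removeComponent_of_inner_eq_zero {v x : H} (h : inner ℝ v x = 0) :
    removeComponent v x = x := by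
  rw [removeComponent_apply, h, mul_zero, zero_smul, sub_zero]

theorem removeComponent_self {v : H} (hv : v ≠ 0) : removeComponent v v = 0 := by
  rw [removeComponent_apply, real_inner_self_eq_norm_sq,
    inv_mul_cancel₀ (pow_ne_zero 2 (norm_ne_zero_iff.2 hv)), one_smul, sub_self]

theorem inner_removeComponent_left (v x y : H) :
    inner ℝ (removeComponent v x) y = inner ℝ x (removeComponent v y) := by
  rw [removeComponent_apply, removeComponent_apply, inner_sub_left, inner_sub_right,
    inner_smul_left, inner_smul_right, real_inner_comm v x]
  simp only [conj_trivial]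
  ring

end

/-! ### The integration operator -/

theorem measurable_lift {f : ℝ → ℝ} (hf : Measurable f) : Measurable (lift f) :=
  (hf.comp measurable_subtype_coe).comp (AddCircle.measurableEquivIoc 1 0).measurable

theorem lift_coe_Ioc {f : ℝ → ℝ} {x : ℝ} (hx : x ∈ Ioc (0 : ℝ) 1) :
    lift f (x : UnitAddCircle) = f x :=
  AddCircle.liftIoc_zero_coe_apply hx

theorem memLp_lift (P : WVPair) {f : ℝ → ℝ} (hf : Measurable f) {C : ℝ} (hC : ∀ x, ‖f x‖ ≤ C)
    (n : ℕ) : MemLp (lift f) 2 (P.meas n) :=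
  MemLp.of_bound (measurable_lift hf).aestronglyMeasurable C (Eventually.of_forall fun _ => hC _)

theorem measurePreserving_coe (P : WVPair) :
    MeasurePreserving (fun x : ℝ => (x : UnitAddCircle)) P.mV (P.meas 0) :=
  ⟨measurable_coe_circle, rfl⟩

/-- Pullback of functions from the torus to the unit interval. -/
def pullback (P : WVPair) : P.L2 0 →ₗᵢ[ℝ] Lp ℝ 2 P.mV :=
  Lp.compMeasurePreservingₗᵢ ℝ _ P.measurePreserving_coe

/-- Pairing with a fixed vector gives both the uniform Cauchy-Schwarz bound and pointwise
convergence of primitives under weak convergence. -/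
theorem primV_eq_inner (P : WVPair) (u : P.L2 0) (y : ℝ) : P.primV (fun x : ℝ => u x) y =
    inner ℝ (indicatorConstLp 2 measurableSet_Iio (measure_ne_top P.mV (Iio y)) (1 : ℝ))
      (P.pullback u) := by
  have hvu : P.pullback u =ᵐ[P.mV] fun x : ℝ => u x :=
    Lp.coeFn_compMeasurePreserving u P.measurePreserving_coe
  rw [L2.inner_indicatorConstLp_one]
  exact (integral_congr_ae (ae_restrict_of_ae hvu)).symm

theorem abs_primV_le (P : WVPair) (u : P.L2 0) (y : ℝ) :
    |P.primV (fun x : ℝ => u x) y| ≤ √(P.V 1) * ‖u‖ := by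
  rw [primV_eq_inner]
  refine (abs_real_inner_le_norm _ _).trans ?_
  rw [norm_indicatorConstLp two_ne_zero ENNReal.ofNat_ne_top, LinearIsometry.norm_map]
  refine mul_le_mul_of_nonneg_right ?_ (norm_nonneg _)
  rw [norm_one, one_mul, ← P.mV_univ, Real.sqrt_eq_rpow]
  simp only [ENNReal.toReal_ofNat]
  exact Real.rpow_le_rpow measureReal_nonneg (measureReal_mono (subset_univ _)) (by norm_num)

theorem memLp_primV (P : WVPair) (u : P.L2 0) :
    MemLp (lift (P.primV fun x : ℝ => u x)) 2 (P.meas 1) :=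
  P.memLp_lift (measurable_primV (P.integrable_coe_L2 u)) (P.abs_primV_le u) 1

theorem primV_add_smul (P : WVPair) (u v : P.L2 0) (c : ℝ) (y : ℝ) :
    P.primV (fun x : ℝ => (u + c • v : P.L2 0) x) y =
      P.primV (fun x : ℝ => u x) y + c * P.primV (fun x : ℝ => v x) y := by
  have h : (fun x : ℝ => (u + c • v : P.L2 0) x) =ᵐ[P.mV] fun x : ℝ => u x + c * v x := by
    have h1 : (u + c • v : P.L2 0) =ᵐ[P.meas 0] fun x => u x + c * v x := by
      filter_upwards [Lp.coeFn_add u (c • v), Lp.coeFn_smul c v] with x h1 h2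
      rw [h1, Pi.add_apply, h2, Pi.smul_apply, smul_eq_mul]
    exact P.ae_meas_iff.1 h1
  rw [primV_congr h, primV, primV, primV, ← integral_const_mul]
  exact integral_add (P.integrable_coe_L2 u).integrableOn
    ((P.integrable_coe_L2 v).const_mul c).integrableOn

theorem primV_linear (P : WVPair) (u v : P.L2 0) (c : ℝ) :
    (P.memLp_primV (u + c • v)).toLp = (P.memLp_primV u).toLp + c • (P.memLp_primV v).toLp := by
  refine Lp.ext ?_
  filter_upwards [(P.memLp_primV (u + c • v)).coeFn_toLp, (P.memLp_primV u).coeFn_toLp,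
    (P.memLp_primV v).coeFn_toLp, Lp.coeFn_add (P.memLp_primV u).toLp
      (c • (P.memLp_primV v).toLp), Lp.coeFn_smul c (P.memLp_primV v).toLp] with x h1 h2 h3 h4 h5
  rw [h1, h4, Pi.add_apply, h5, Pi.smul_apply, h2, h3]
  exact P.primV_add_smul u v c _

/-- The operator `u ↦ ∫_{[0,·)} u dV` from `L²_V` to `L²_W`. -/
def intV (P : WVPair) : P.L2 0 →L[ℝ] P.L2 1 :=
  LinearMap.mkContinuous
    { toFun := fun u => (P.memLp_primV u).toLp
      map_add' := fun u v => by simpa using P.primV_linear u v 1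
      map_smul' := fun c u => by
        -- Zero arguments with factor `-1` show that the image of 0 is 0.
        have h0 := P.primV_linear 0 0 (-1)
        have h := P.primV_linear 0 u c
        have h1 : (P.memLp_primV 0).toLp = 0 := by simpa using h0
        rw [h1, zero_add] at h
        simpa using h }
    ((measureUnivNNReal (P.meas 1) : ℝ) ^ (2 : ENNReal).toReal⁻¹ * √(P.V 1)) fun u => by
      rw [mul_assoc]
      refine Lp.norm_le_of_ae_bound (mul_nonneg (Real.sqrt_nonneg _) (norm_nonneg u)) ?_
      filter_upwards [(P.memLp_primV u).coeFn_toLp] with x hx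
      rw [LinearMap.coe_mk, AddHom.coe_mk, hx]
      exact P.abs_primV_le u _

theorem intV_ae (P : WVPair) (u : P.L2 0) :
    ∀ᵐ x ∂P.mW, P.intV u ((x : ℝ) : UnitAddCircle) = P.primV (fun x : ℝ => u x) x := by
  have h : P.intV u =ᵐ[P.meas 1] lift (P.primV fun x : ℝ => u x) := (P.memLp_primV u).coeFn_toLp
  filter_upwards [P.ae_meas_iff.1 h, P.ae_mW_mem] with x hx hx1
  rw [hx, lift_coe_Ioc hx1]

theorem norm_intV_sub_sq (P : WVPair) (u v : P.L2 0) : ‖P.intV u - P.intV v‖ ^ 2 =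
    ∫ y, (P.primV (fun x : ℝ => u x) y - P.primV (fun x : ℝ => v x) y) ^ 2 ∂P.mW := by
  rw [← real_inner_self_eq_norm_sq, inner_L2, P.integral_meas
    (f := fun x => (P.intV u - P.intV v : P.L2 1) x * (P.intV u - P.intV v : P.L2 1) x)
    ((Lp.aestronglyMeasurable _).mul (Lp.aestronglyMeasurable _))]
  refine integral_congr_ae ?_
  change _ =ᵐ[P.mW] _
  filter_upwards [P.ae_meas_iff.1 (Lp.coeFn_sub (P.intV u) (P.intV v)), P.intV_ae u, P.intV_ae v]
    with x h1 h2 h3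
  rw [h1, Pi.sub_apply, h2, h3, sq]

/-- The primitives converge pointwise and are bounded uniformly on the unit ball; `dW` being finite
on a period, dominated convergence gives convergence in norm. -/
theorem tendsto_intV_of_weak (P : WVPair) {u : ℕ → P.L2 0} {v : P.L2 0} (hu : ∀ n, ‖u n‖ ≤ 1)
    (h : ∀ w, Tendsto (fun n => inner ℝ (u n) w) atTop (𝓝 (inner ℝ v w))) :
    Tendsto (fun n => P.intV (u n)) atTop (𝓝 (P.intV v)) := by
  have hpt : ∀ y, Tendsto (fun n => P.primV (fun x : ℝ => u n x) y) atTop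
      (𝓝 (P.primV (fun x : ℝ => v x) y)) := by
    intro y
    have h1 := h (P.pullback.toContinuousLinearMap.adjoint
      (indicatorConstLp 2 measurableSet_Iio (measure_ne_top P.mV (Iio y)) (1 : ℝ)))
    simp_rw [ContinuousLinearMap.adjoint_inner_right] at h1
    simp_rw [primV_eq_inner, real_inner_comm (P.pullback _)]
    exact h1
  rw [tendsto_iff_norm_sub_tendsto_zero]
  have hsq : Tendsto (fun n => ‖P.intV (u n) - P.intV v‖ ^ 2) atTop (𝓝 0) := by
    simp_rw [norm_intV_sub_sq]
    have h0 : (0 : ℝ) = ∫ _, (0 : ℝ) ∂P.mW := by simp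
    rw [h0]
    refine tendsto_integral_filter_of_dominated_convergence
      (fun _ => (√(P.V 1) * 1 + √(P.V 1) * ‖v‖) ^ 2) (Eventually.of_forall fun n => ?_)
      (Eventually.of_forall fun n => Eventually.of_forall fun y => ?_) (integrable_const _)
      (Eventually.of_forall fun y => ?_)
    · exact (((measurable_primV (P.integrable_coe_L2 (u n))).sub
        (measurable_primV (P.integrable_coe_L2 v))).pow_const 2).aestronglyMeasurable
    · rw [Real.norm_eq_abs, abs_pow]
      refine pow_le_pow_left₀ (abs_nonneg _) ((abs_sub _ _).trans (add_le_add ?_ ?_)) 2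
      · exact (P.abs_primV_le (u n) y).trans
          (mul_le_mul_of_nonneg_left (hu n) (Real.sqrt_nonneg _))
      · exact P.abs_primV_le v y
    · have := ((hpt y).sub_const (P.primV (fun x : ℝ => v x) y)).pow 2
      simpa using this
  have := hsq.sqrt
  simpa using this

/-- Separability is what makes the sequential form of Banach-Alaoglu available in
`isCompactOperator_intV`. -/
theorem secondCountable_L2 (P : WVPair) : SecondCountableTopology (P.L2 0) := by
  have : Fact ((2 : ENNReal) ≠ ⊤) := ⟨ENNReal.ofNat_ne_top⟩
  have : MeasurableSpace.CountablyGenerated UnitAddCircle := inferInstance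
  have : MeasureTheory.IsSeparable (P.meas 0) := inferInstance
  exact Lp.SecondCountableTopology

/-- A sequence in the unit ball has a subsequence converging weakly to a point of the ball, and
`intV` makes the convergence strong. The image of the closed ball is therefore itself compact. -/
theorem isCompactOperator_intV (P : WVPair) : IsCompactOperator P.intV := by
  refine ⟨P.intV '' Metric.closedBall 0 1, IsSeqCompact.isCompact ?_,
    mem_of_superset (Metric.closedBall_mem_nhds 0 one_pos) (subset_preimage_image _ _)⟩
  have := P.secondCountable_L2
  intro x hx
  choose u hu hux using hx
  have hu1 : ∀ n, ‖u n‖ ≤ 1 := fun n => mem_closedBall_zero_iff.1 (hu n)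
  obtain ⟨d, hd, φ, hφ, hlim⟩ := WeakDual.isSeqCompact_closedBall ℝ (P.L2 0) 0 1
    (x := fun n => StrongDual.toWeakDual (InnerProductSpace.toDual ℝ (P.L2 0) (u n))) (fun n => by
      refine mem_preimage.2 (mem_closedBall_zero_iff.2 ?_)
      refine le_trans (le_of_eq ?_) (hu1 n)
      exact (InnerProductSpace.toDual ℝ (P.L2 0)).norm_map (u n))
  set v : P.L2 0 := (InnerProductSpace.toDual ℝ (P.L2 0)).symm (WeakDual.toStrongDual d) with hv
  have hvn : ‖v‖ ≤ 1 := by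
    rw [hv, LinearIsometryEquiv.norm_map]
    exact mem_closedBall_zero_iff.1 (mem_preimage.1 hd)
  refine ⟨P.intV v, ⟨v, mem_closedBall_zero_iff.2 hvn, rfl⟩, φ, hφ, ?_⟩
  have : x ∘ φ = fun n => P.intV (u (φ n)) := funext fun n => (hux _).symm
  rw [this]
  refine P.tendsto_intV_of_weak (fun n => hu1 _) fun w => ?_
  have h1 := ((WeakDual.eval_continuous w).tendsto d).comp hlim
  have h2 : inner ℝ v w = d w := by
    rw [hv, InnerProductSpace.toDual_symm_apply]; rfl
  rw [h2]
  exact h1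

/-! ### Existence of eigenbases -/

/-- The constant function `1`. -/
def one (P : WVPair) (n : ℕ) : P.L2 n := Lp.const 2 (P.meas n) (1 : ℝ)

theorem one_ae (P : WVPair) (n : ℕ) : P.one n =ᵐ[P.meas n] fun _ => 1 :=
  Lp.coeFn_const 2 (P.meas n) (1 : ℝ)

theorem inner_one (P : WVPair) {n : ℕ} (u : P.L2 n) :
    inner ℝ (P.one n) u = ∫ x : ℝ, u (x : UnitAddCircle) ∂(P.mI n) := by
  rw [P.inner_L2_of_ae (P.one_ae n) (EventuallyEq.refl _ _), ← P.integral_coe_L2]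
  simp

theorem norm_one_zero (P : WVPair) : ‖P.one 0‖ ^ 2 = P.V 1 := by
  rw [← real_inner_self_eq_norm_sq, P.inner_L2_of_ae (P.one_ae 0) (P.one_ae 0)]
  simp [P.measureReal_meas_zero]

theorem norm_one_one (P : WVPair) : ‖P.one 1‖ ^ 2 = P.W 1 := by
  rw [← real_inner_self_eq_norm_sq, P.inner_L2_of_ae (P.one_ae 1) (P.one_ae 1)]
  simp [P.measureReal_meas_one]

theorem one_zero_ne_zero (P : WVPair) : P.one 0 ≠ 0 := fun h => by
  have := P.norm_one_zero
  rw [h, norm_zero] at this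
  linarith [P.V_one_pos]

theorem one_one_ne_zero (P : WVPair) : P.one 1 ≠ 0 := fun h => by
  have := P.norm_one_one
  rw [h, norm_zero] at this
  linarith [P.W_one_pos]

/-- Integration with respect to `dV` between the spaces of functions with vanishing mean. -/
def intV₀ (P : WVPair) : P.L2 0 →L[ℝ] P.L2 1 :=
  removeComponent (P.one 1) ∘L P.intV ∘L removeComponent (P.one 0)

/-- The inverse of the negative Laplacian. -/
def invLap (P : WVPair) : P.L2 0 →L[ℝ] P.L2 0 := P.intV₀.adjoint ∘L P.intV₀

theorem isCompactOperator_invLap (P : WVPair) : IsCompactOperator P.invLap :=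
  ((P.isCompactOperator_intV.comp_clm (removeComponent (P.one 0))).clm_comp
    (removeComponent (P.one 1))).clm_comp P.intV₀.adjoint

theorem inner_invLap (P : WVPair) (x y : P.L2 0) :
    inner ℝ (P.invLap x) y = inner ℝ (P.intV₀ x) (P.intV₀ y) := by
  rw [invLap, ContinuousLinearMap.comp_apply, ContinuousLinearMap.adjoint_inner_left]

theorem isSymmetric_invLap (P : WVPair) : (P.invLap : P.L2 0 →ₗ[ℝ] P.L2 0).IsSymmetric :=
  fun x y => by
    simp only [ContinuousLinearMap.coe_coe]
    rw [inner_invLap, real_inner_comm, ← inner_invLap, real_inner_comm]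

theorem intV₀_one (P : WVPair) : P.intV₀ (P.one 0) = 0 := by
  simp [intV₀, removeComponent_self P.one_zero_ne_zero]

theorem intV₀_ae (P : WVPair) {u : P.L2 0} (hu : inner ℝ (P.one 0) u = 0) : ∃ c : ℝ,
    ∀ᵐ x : ℝ ∂P.mW, P.intV₀ u (x : UnitAddCircle) = P.primV (fun s : ℝ => u s) x - c := by
  refine ⟨(‖P.one 1‖ ^ 2)⁻¹ * inner ℝ (P.one 1) (P.intV u), ?_⟩
  set c := (‖P.one 1‖ ^ 2)⁻¹ * inner ℝ (P.one 1) (P.intV u) with hc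
  have h : P.intV₀ u = P.intV u - c • P.one 1 := by
    rw [intV₀, ContinuousLinearMap.comp_apply, ContinuousLinearMap.comp_apply,
      removeComponent_of_inner_eq_zero hu, removeComponent_apply]
  have h1 : P.intV₀ u =ᵐ[P.meas 1] fun x => P.intV u x - c := by
    rw [h]
    filter_upwards [Lp.coeFn_sub (P.intV u) (c • P.one 1), Lp.coeFn_smul c (P.one 1), P.one_ae 1]
      with x h1 h2 h3
    rw [h1, Pi.sub_apply, h2, Pi.smul_apply, h3, smul_eq_mul, mul_one]
  filter_upwards [P.ae_meas_iff.1 h1, P.intV_ae u] with x h2 h3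
  rw [h2, h3]

theorem eq_smul_one_of_inner_eq {P : WVPair} {u : P.L2 0}
    (h : removeComponent (P.one 0) u = 0) : ∃ c : ℝ, u = c • P.one 0 := by
  rw [removeComponent_apply, sub_eq_zero] at h
  exact ⟨_, h⟩

/-- Since `inner (invLap u) u` is the squared norm of `intV₀ u`, the kernel is that of `intV₀`. For
the mean-zero part of `u` this says that its primitive is constant `dW`-a.e., which forces that part
to vanish. -/
theorem invLap_eq_zero_iff (P : WVPair) (u : P.L2 0) :
    P.invLap u = 0 ↔ ∃ c : ℝ, u = c • P.one 0 := by
  constructor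
  · intro h
    refine eq_smul_one_of_inner_eq ?_
    have hA : P.intV₀ u = 0 := by
      rw [← inner_self_eq_zero (𝕜 := ℝ), ← inner_invLap, h, inner_zero_left]
    set v := removeComponent (P.one 0) u with hv
    have hv0 : inner ℝ (P.one 0) v = 0 := inner_removeComponent P.one_zero_ne_zero u
    have hAv : P.intV₀ v = 0 := by
      rw [hv, removeComponent_apply, map_sub, map_smul, intV₀_one, smul_zero, sub_zero, hA]
    obtain ⟨c, hc⟩ := P.intV₀_ae hv0
    have hz : ∀ᵐ x : ℝ ∂P.mW, P.intV₀ v (x : UnitAddCircle) = 0 := by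
      rw [hAv]
      exact P.ae_meas_iff.1 (Lp.coeFn_zero ℝ 2 (P.meas 1))
    rw [Lp.eq_zero_iff_ae_eq_zero]
    refine P.ae_meas_iff.2 (P.ae_eq_zero_of_primV_eq_const (c := c) (P.integrable_coe_L2 v) ?_ ?_)
    · rw [inner_one] at hv0
      exact hv0
    · filter_upwards [hc, hz] with x h1 h2
      rw [h2] at h1
      linarith
  · rintro ⟨c, rfl⟩
    rw [invLap, ContinuousLinearMap.comp_apply, map_smul, intV₀_one, smul_zero, map_zero]

theorem inner_one_invLap (P : WVPair) (u : P.L2 0) : inner ℝ (P.one 0) (P.invLap u) = 0 := by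
  rw [real_inner_comm, inner_invLap, intV₀_one, inner_zero_right]

/-- The adjoint of integration with respect to `dV` is, up to sign and constants, integration with
respect to `dW`. -/
theorem invLap_ae (P : WVPair) (u : P.L2 0) : ∃ d : ℝ, ∀ᵐ x : ℝ ∂P.mV,
    P.invLap u (x : UnitAddCircle) = d - P.primW (fun t : ℝ => P.intV₀ u t) x := by
  set F := P.intV₀ u with hF
  have hFi : Integrable (fun t : ℝ => F t) P.mW := P.integrable_coe_L2 F
  have hF1 : inner ℝ (P.one 1) F = 0 := inner_removeComponent P.one_one_ne_zero _
  have hwm : MemLp (lift (P.primW fun t : ℝ => F t)) 2 (P.meas 0) :=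
    P.memLp_lift (measurable_primW hFi) (norm_primW_le hFi) 0
  set w : P.L2 0 := hwm.toLp with hw
  have hwae : ∀ᵐ x : ℝ ∂P.mV, w (x : UnitAddCircle) = P.primW (fun t : ℝ => F t) x := by
    filter_upwards [P.ae_meas_iff.1 hwm.coeFn_toLp, P.ae_mV_mem] with x h1 h2
    rw [hw, h1, lift_coe_Ioc h2]
  have key : P.invLap u = -removeComponent (P.one 0) w := by
    -- The symmetric projections are shifted onto `g` and `F`, where mean zero is available; what
    -- remains is `integral_primW_mul`.
    refine ext_inner_right ℝ fun g => ?_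
    rw [inner_invLap, inner_neg_left, inner_removeComponent_left, ← hF]
    set g₀ := removeComponent (P.one 0) g with hg₀
    have hg0 : inner ℝ (P.one 0) g₀ = 0 := inner_removeComponent P.one_zero_ne_zero g
    rw [intV₀, ContinuousLinearMap.comp_apply, ContinuousLinearMap.comp_apply,
      ← inner_removeComponent_left, removeComponent_of_inner_eq_zero hF1, ← hg₀, inner_L2, inner_L2,
      P.integral_meas (f := fun x => F x * P.intV g₀ x)
        ((Lp.aestronglyMeasurable _).mul (Lp.aestronglyMeasurable _)),
      P.integral_meas (f := fun x => w x * g₀ x)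
        ((Lp.aestronglyMeasurable _).mul (Lp.aestronglyMeasurable _))]
    rw [inner_one] at hg0
    have h1 := P.integral_primW_mul hFi (P.integrable_coe_L2 g₀) hg0
    have h2 : ∫ x : ℝ, F x * P.intV g₀ x ∂P.mW =
        ∫ t : ℝ, F t * P.primV (fun s : ℝ => g₀ s) t ∂P.mW :=
      integral_congr_ae ((P.intV_ae g₀).mono fun x hx => by simp only [hx])
    have h3 : ∫ x : ℝ, w x * g₀ x ∂P.mV = ∫ x : ℝ, P.primW (fun t : ℝ => F t) x * g₀ x ∂P.mV :=
      integral_congr_ae (hwae.mono fun x hx => by simp only [hx])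
    change ∫ x : ℝ, F x * P.intV g₀ x ∂P.mW = -∫ x : ℝ, w x * g₀ x ∂P.mV
    rw [h2, h3, h1, neg_neg]
  set d := (‖P.one 0‖ ^ 2)⁻¹ * inner ℝ (P.one 0) w with hd
  have h1 : P.invLap u =ᵐ[P.meas 0] fun x => d - w x := by
    rw [key, removeComponent_apply, neg_sub]
    filter_upwards [Lp.coeFn_sub (d • P.one 0) w, Lp.coeFn_smul d (P.one 0), P.one_ae 0]
      with x h1 h2 h3
    rw [h1, Pi.sub_apply, h2, Pi.smul_apply, h3, smul_eq_mul, mul_one]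
  refine ⟨d, ?_⟩
  filter_upwards [P.ae_meas_iff.1 h1, hwae] with x h2 h3
  rw [h2, h3]

theorem primW_congr {P : WVPair} {F G : ℝ → ℝ} (h : F =ᵐ[P.mW] G) : P.primW F = P.primW G :=
  funext fun _ => integral_congr_ae (ae_restrict_of_ae h)

theorem coe_neg_smul (P : WVPair) (c : ℝ) (u : P.L2 0) :
    (fun s : ℝ => (-(c • u) : P.L2 0) (s : UnitAddCircle)) =ᵐ[P.mV] fun s : ℝ => -c * u s := by
  have h1 : (-(c • u) : P.L2 0) =ᵐ[P.meas 0] fun x => -c * u x := by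
    filter_upwards [Lp.coeFn_neg (c • u), Lp.coeFn_smul c u] with x h1 h2
    rw [h1, Pi.neg_apply, h2, Pi.smul_apply, smul_eq_mul, neg_mul]
  exact P.ae_meas_iff.1 h1

theorem isLaplacian_of_invLap (P : WVPair) {u : P.L2 0} {c : ℝ} (hc : c ≠ 0)
    (h : P.invLap u = c⁻¹ • u) : P.IsLaplacian u (-(c • u)) := by
  have hu : u = c • P.invLap u := by rw [h, smul_smul, mul_inv_cancel₀ hc, one_smul]
  have hu0 : inner ℝ (P.one 0) u = 0 := by
    rw [hu, inner_smul_right, inner_one_invLap, mul_zero]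
  obtain ⟨a, ha⟩ := P.intV₀_ae hu0
  obtain ⟨d, hd⟩ := P.invLap_ae u
  have hF1 : inner ℝ (P.one 1) (P.intV₀ u) = 0 := inner_removeComponent P.one_one_ne_zero _
  rw [inner_one] at hu0 hF1
  have hprim : ∀ y, P.primV (fun s : ℝ => (-(c • u) : P.L2 0) (s : UnitAddCircle)) y =
      -c * P.primV (fun s : ℝ => u s) y := fun y => by
    rw [primV_congr (P.coe_neg_smul c u), primV, integral_const_mul, primV]
  have hF : (fun y => c * a + P.primV (fun s : ℝ => (-(c • u) : P.L2 0) (s : UnitAddCircle)) y)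
      =ᵐ[P.mW] fun y : ℝ => -c * P.intV₀ u y := by
    filter_upwards [ha] with y hy
    rw [hprim, hy]; ring
  -- Multiplying `invLap u = d - primW (primV u - a)` by `c` gives `u = c d + primW (c a + primV (-c
  -- u))`.
  refine P.isLaplacian_iff.2 ⟨?_, c * d, c * a, ?_, ?_⟩
  · rw [integral_congr_ae (P.coe_neg_smul c u), integral_const_mul]
    exact mul_eq_zero_of_right _ hu0
  · rw [integral_congr_ae hF, integral_const_mul]
    exact mul_eq_zero_of_right _ hF1
  · have h1 : u =ᵐ[P.meas 0] fun x => c * P.invLap u x := by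
      conv_lhs => rw [hu]
      exact Lp.coeFn_smul c (P.invLap u)
    filter_upwards [hd, P.ae_meas_iff.1 h1] with x h2 h3
    rw [h3, h2, primW_congr hF, primW, primW, integral_const_mul]
    ring

theorem isLaplacian_smul_one (P : WVPair) (c : ℝ) :
    P.IsLaplacian (c • P.one 0) (-((0 : ℝ) • (c • P.one 0))) := by
  have h0 : (fun s : ℝ => (-((0 : ℝ) • (c • P.one 0)) : P.L2 0) (s : UnitAddCircle)) =ᵐ[P.mV]
      fun _ => 0 := (P.coe_neg_smul 0 (c • P.one 0)).trans (Eventually.of_forall fun s => by simp)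
  have hp : ∀ y, P.primV (fun s : ℝ =>
      (-((0 : ℝ) • (c • P.one 0)) : P.L2 0) (s : UnitAddCircle)) y = 0 := fun y => by
    rw [primV_congr h0, primV]; simp
  refine P.isLaplacian_iff.2 ⟨?_, c, 0, ?_, ?_⟩
  · rw [integral_congr_ae h0]; simp
  · simp only [hp]; simp
  · have h1 : (c • P.one 0 : P.L2 0) =ᵐ[P.meas 0] fun _ => c := by
      filter_upwards [Lp.coeFn_smul c (P.one 0), P.one_ae 0] with x h1 h2
      rw [h1, Pi.smul_apply, h2, smul_eq_mul, mul_one]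
    filter_upwards [P.ae_meas_iff.1 h1] with x hx
    rw [hx]
    simp only [primW, hp]
    simp

/-- Indicators of the disjoint intervals `[1/(n+2), 1/(n+1))` are orthogonal, and nonzero because
`V` is strictly increasing. -/
theorem not_finiteDimensional_L2 (P : WVPair) : ¬ FiniteDimensional ℝ (P.L2 0) := by
  intro hfin
  set s : ℕ → Set ℝ := fun n => Ico (1 / ((n : ℝ) + 2)) (1 / ((n : ℝ) + 1)) with hs
  have hdisj : ∀ m n, m < n → ∀ x, x ∈ s m → x ∉ s n := by
    intro m n hmn x hm hn
    have h1 : (m : ℝ) + 2 ≤ n + 1 := by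
      have : (m : ℝ) + 1 ≤ n := by exact_mod_cast hmn
      linarith
    have h2 : 1 / ((n : ℝ) + 1) ≤ 1 / ((m : ℝ) + 2) :=
      one_div_le_one_div_of_le (by positivity) h1
    linarith [hm.1, hn.2]
  have hmeas : ∀ n, Measurable ((s n).indicator fun _ => (1 : ℝ)) := fun n =>
    measurable_const.indicator measurableSet_Ico
  have hmem : ∀ n, MemLp (lift ((s n).indicator fun _ => (1 : ℝ))) 2 (P.meas 0) := fun n =>
    P.memLp_lift (C := 1) (hmeas n) (fun x => by
      by_cases hx : x ∈ s n <;> simp [hx]) 0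
  have hinner : ∀ m n, inner ℝ (hmem m).toLp (hmem n).toLp =
      ∫ x, (s m).indicator (fun _ => (1 : ℝ)) x * (s n).indicator (fun _ => (1 : ℝ)) x ∂P.mV := by
    intro m n
    rw [P.inner_L2_of_ae (hmem m).coeFn_toLp (hmem n).coeFn_toLp, P.integral_meas_of_measurable _
      (f := fun x => lift ((s m).indicator fun _ => (1 : ℝ)) x *
        lift ((s n).indicator fun _ => (1 : ℝ)) x)
      ((measurable_lift (hmeas m)).mul (measurable_lift (hmeas n)))]
    refine integral_congr_ae (P.ae_mV_mem.mono fun x hx => ?_)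
    simp only [lift_coe_Ioc hx]
  have horth : ∀ m n, m < n → inner ℝ (hmem m).toLp (hmem n).toLp = 0 := by
    intro m n hmn
    rw [hinner]
    refine integral_eq_zero_of_ae (Eventually.of_forall fun x => ?_)
    by_cases hx : x ∈ s m
    · simp [hdisj m n hmn x hx]
    · simp [hx]
  have hne : ∀ n, (hmem n).toLp ≠ 0 := by
    intro n h0
    have h1 := hinner n n
    rw [h0, inner_zero_left] at h1
    have h2 : ∀ x, (s n).indicator (fun _ => (1 : ℝ)) x * (s n).indicator (fun _ => (1 : ℝ)) x =
        (s n).indicator (fun _ => (1 : ℝ)) x := fun x => by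
      by_cases hx : x ∈ s n <;> simp [hx]
    have hlt : 1 / ((n : ℝ) + 2) < 1 / ((n : ℝ) + 1) :=
      one_div_lt_one_div_of_lt (by positivity) (by linarith)
    simp_rw [h2] at h1
    rw [integral_indicator_const _ measurableSet_Ico, smul_eq_mul, mul_one,
      P.mV_Ico (by positivity) hlt.le (by
        rw [div_le_one (by positivity)]; linarith [(Nat.cast_nonneg n : (0 : ℝ) ≤ n)])] at h1
    linarith [P.V_strictMono hlt]
  have hli : LinearIndependent ℝ fun n => (hmem n).toLp := by
    refine linearIndependent_of_ne_zero_of_inner_eq_zero hne fun m n hmn => ?_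
    rcases lt_or_gt_of_ne hmn with h | h
    · exact horth m n h
    · rw [real_inner_comm]; exact horth n m h
  have := hli.finite_of_isNoetherian
  exact not_finite ℕ

theorem exists_isEigenbasis (P : WVPair) :
    ∃ (ν : ℕ → P.L2 0) (lam : ℕ → ℝ), P.IsEigenbasis ν lam ∧ Tendsto lam atTop atTop := by
  have hV : 0 < √(P.V 1) := Real.sqrt_pos.2 P.V_one_pos
  have hn : ‖P.one 0‖ = √(P.V 1) := by
    rw [← P.norm_one_zero, Real.sqrt_sq (norm_nonneg _)]
  obtain ⟨ν, lam, h1, h2, h3, h4, h5, h6, h7⟩ := exists_sorted_eigenbasis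
    P.isCompactOperator_invLap P.isSymmetric_invLap
    (fun x => by rw [inner_invLap]; exact real_inner_self_nonneg)
    (v₀ := (√(P.V 1))⁻¹ • P.one 0)
    (by rw [norm_smul, hn, norm_inv, Real.norm_of_nonneg hV.le, inv_mul_cancel₀ hV.ne'])
    (fun x => by
      rw [invLap_eq_zero_iff]
      constructor
      · rintro ⟨c, rfl⟩
        exact ⟨c * √(P.V 1), by rw [smul_smul, mul_assoc, mul_inv_cancel₀ hV.ne', mul_one]⟩
      · rintro ⟨c, rfl⟩
        exact ⟨_, smul_smul _ _ _⟩) P.not_finiteDimensional_L2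
  refine ⟨ν, lam, ⟨h1, h2, ?_, h4, h5⟩, h6⟩
  rintro (_ | i)
  · rw [h3, h4]
    exact P.isLaplacian_smul_one _
  · exact P.isLaplacian_of_invLap (h7 i).1.ne' (h7 i).2

end

end WVPair

/-! ### Assembly of the three statements -/

theorem mainTheorem10 (P : WVPair) :
    (∃ (ν : ℕ → P.L2 0) (lam : ℕ → ℝ), P.IsEigenbasis ν lam ∧ Tendsto lam atTop atTop) ∧
    (∀ (ν : ℕ → P.L2 0) (lam : ℕ → ℝ), P.IsEigenbasis ν lam → ∀ k : ℕ,
      P.Hk k = {f : P.L2 0 | ∃ α : ℕ → ℝ,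
        HasSum (fun i : ℕ => α (i + 1) • ν (i + 1)) (f - Lp.const 2 (P.meas 0) (α 0)) ∧
        Summable (fun i : ℕ => lam (i + 1) ^ k * α (i + 1) ^ 2)}) ∧
    (∀ k : ℕ, P.smoothClasses ⊆ P.Hk k ∧
      ∀ f ∈ P.Hk k, ∀ ε : ℝ, 0 < ε → ∃ h ∈ P.smoothClasses, P.sobNorm k (f - h) < ε) := by
  refine ⟨P.exists_isEigenbasis, fun ν lam h k => ?_, fun k => ⟨P.smoothClasses_subset_Hk k, ?_⟩⟩
  · obtain ⟨e, E, S, hE⟩ := h.exists_system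
    simp_rw [← hE]
    exact S.Hk_eq k
  -- Density does not refer to an eigensystem, so any one of them serves.
  · obtain ⟨ν, lam, h, -⟩ := P.exists_isEigenbasis
    obtain ⟨e, E, S, -⟩ := h.exists_system
    exact fun f hf ε hε => S.exists_smooth_near hf hε
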